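/- Let $k$ be an algebraically closed field of characteristic $0$, and let $K_0(\mathrm{Var}_k)$ be the Grothendieck ring of varieties over $k$: it is generated by the classes $[X]$ of varieties over $k$ (separated schemes of finite type), subject to $[X]=[Y]$ if $X\cong Y$, $[X]=[Z]+[X\setminus Z]$ for $Z\subseteq X$ closed, $[X\times_k Y]=[X][Y]$ and $[\operatorname{Spec} k]=1$. Let $\Lambda$ be an integral domain of characteristic $0$ (for instance $\mathbb{Z}$, $\mathbb{Q}$ or $k$), put $K_\Lambda=\Lambda\otimes_{\mathbb{Z}}K_0(\mathrm{Var}_k)$, $\mathbb{L}=[\mathbb{A}^1_k]$, and let $R=\Lambda[\mathbb{L}]\subseteq K_\Lambda$ be the subring of polynomials in $\mathbb{L}$. Let $Y\subset\mathbb{P}^3_k$ be a smooth cubic surface, $Y^{(2)}=(Y\times Y)/S_2$ its symmetric square, and $F(Y)\subset\mathbb{G}(1,3)$ the Fano variety of lines contained in $Y$. A polynomial relation among $[Y],[Y^{(2)}],[F(Y)]$ with coefficients in $R$ is a polynomial $g\in R[u_0,u_1,u_2]$ with $g([Y],[Y^{(2)}],[F(Y)])=0$ in $K_\Lambda$. Then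 the $Y$–$F(Y)$ relation, that is, the polynomial $$r=u_1-(1+\mathbb{L}^2)u_0-\mathbb{L}^2u_2$$ with value $[Y^{(2)}]-(1+\mathbb{L}^2)[Y]-\mathbb{L}^2[F(Y)]$, does not generate all polynomial relations with zero constant term: there is a polynomial relation $g\in R[u_0,u_1,u_2]$ among $[Y],[Y^{(2)}],[F(Y)]$ with zero constant term such that $g$ does not lie in the ideal of $R[u_0,u_1,u_2]$ generated by $r$, and $g\neq A(r)$ for every polynomial $A\in R[X]$. -/

import Mathlib

open CategoryTheory CategoryTheory.Limits AlgebraicGeometry TensorProduct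

universe u v

noncomputable section

namespace CubicSurface

/-- A variety over `k`: a separated scheme of finite type over `Spec k`. (Reducedness is not
imposed; in the Grothendieck ring a scheme and its reduction have the same class, because the
reduction is a closed subscheme with empty complement.) -/
structure Variety (k : Type u) [Field k] where
  /-- the underlying scheme -/
  carrier : Scheme.{u}
  /-- the structure morphism -/
  str : carrier ⟶ Spec (.of k)
  sep : IsSeparated str
  lft : LocallyOfFiniteType str
  qc : QuasiCompact str

attribute [instance] Variety.sep Variety.lft Variety.qc

namespace Variety

variable {k : Type u} [Field k]

/-- The fibre product over `Spec k`. -/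
def prod (X Y : Variety k) : Variety k where
  carrier := pullback X.str Y.str
  str := pullback.fst X.str Y.str ≫ X.str
  sep := inferInstance
  lft := inferInstance
  qc := inferInstance

/-- `Spec k` as a variety over `k`. -/
def point (k : Type u) [Field k] : Variety k where
  carrier := Spec (.of k)
  str := 𝟙 _
  sep := inferInstance
  lft := inferInstance
  qc := inferInstance

/-- The affine line `Spec k[t]`. -/
def affineLine (k : Type u) [Field k] : Variety k where
  carrier := Spec (.of (Polynomial k))
  str := Spec.map (CommRingCat.ofHom (Polynomial.C : k →+* Polynomial k))
  sep := inferInstance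
  lft := by
    rw [HasRingHomProperty.Spec_iff (P := @LocallyOfFiniteType)]
    exact (RingHom.finiteType_algebraMap (A := k) (B := Polynomial k)).mpr inferInstance
  qc := inferInstance

/-- Isomorphism of varieties over `k`. -/
def Iso (X Y : Variety k) : Prop :=
  ∃ e : X.carrier ≅ Y.carrier, e.hom ≫ Y.str = X.str

/-- `X` is cut into a closed subvariety isomorphic to `Z` and the complementary open subvariety,
isomorphic to `U`. -/
def IsCut (X Z U : Variety k) : Prop :=
  ∃ (i : Z.carrier ⟶ X.carrier) (j : U.carrier ⟶ X.carrier),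
    IsClosedImmersion i ∧ IsOpenImmersion j ∧ i ≫ X.str = Z.str ∧ j ≫ X.str = U.str ∧
      Set.range j = (Set.range i)ᶜ

end Variety

/-- The relations that define the Grothendieck ring of varieties. -/
inductive K0Rel (k : Type u) [Field k] : MvPolynomial (Variety k) ℤ → Prop
  | iso (X Y : Variety k) (h : X.Iso Y) : K0Rel k (MvPolynomial.X X - MvPolynomial.X Y)
  | cut (X Z U : Variety k) (h : X.IsCut Z U) :
      K0Rel k (MvPolynomial.X X - MvPolynomial.X Z - MvPolynomial.X U)
  | prod (X Y : Variety k) :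
      K0Rel k (MvPolynomial.X (X.prod Y) - MvPolynomial.X X * MvPolynomial.X Y)
  | point : K0Rel k (MvPolynomial.X (Variety.point k) - 1)

/-- The Grothendieck ring of varieties over `k`: generated by the symbols `[X]`, subject to
`[X] = [Y]` if `X ≅ Y`, `[X] = [Z] + [X \ Z]` for `Z ⊆ X` closed, `[X × Y] = [X][Y]`
and `[Spec k] = 1`. -/
def K0 (k : Type u) [Field k] : Type (u + 1) :=
  MvPolynomial (Variety k) ℤ ⧸ Ideal.span {p | K0Rel k p}

instance (k : Type u) [Field k] : CommRing (K0 k) :=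
  inferInstanceAs (CommRing (MvPolynomial (Variety k) ℤ ⧸ Ideal.span {p | K0Rel k p}))

namespace Variety

variable {k : Type u} [Field k]

/-- The class `[X]` in the Grothendieck ring. -/
def cls (X : Variety k) : K0 k :=
  Ideal.Quotient.mk (Ideal.span {p | K0Rel k p}) (MvPolynomial.X X)

/-- The involution of `X × X` that exchanges the two factors. -/
def swap (X : Variety k) : (X.prod X).carrier ⟶ (X.prod X).carrier :=
  (pullbackSymmetry X.str X.str).hom

/-- `Q` is the symmetric square `(X × X) / S₂`: it comes with an `S₂`-invariant morphism
`π : X × X ⟶ Q` of `k`-schemes which is universal among the `S₂`-invariant morphisms from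
`X × X` to `k`-schemes. -/
def IsSymmetricSquare (X Q : Variety k) : Prop :=
  ∃ π : (X.prod X).carrier ⟶ Q.carrier,
    π ≫ Q.str = (X.prod X).str ∧ X.swap ≫ π = π ∧
      ∀ (T : Scheme.{u}) (t : T ⟶ Spec (.of k)) (f : (X.prod X).carrier ⟶ T),
        f ≫ t = (X.prod X).str → X.swap ≫ f = f →
          ∃! g : Q.carrier ⟶ T, g ≫ t = Q.str ∧ π ≫ g = f

theorem IsSymmetricSquare.iso {X Q Q' : Variety k} (h : X.IsSymmetricSquare Q)
    (h' : X.IsSymmetricSquare Q') : Q.Iso Q' := by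
  obtain ⟨π, hπ, hs, hu⟩ := h
  obtain ⟨π', hπ', hs', hu'⟩ := h'
  obtain ⟨a, ⟨ha, ha'⟩, -⟩ := hu Q'.carrier Q'.str π' hπ' hs'
  obtain ⟨b, ⟨hb, hb'⟩, -⟩ := hu' Q.carrier Q.str π hπ hs
  refine ⟨⟨a, b, ?_, ?_⟩, ha⟩
  · exact (hu Q.carrier Q.str π hπ hs).unique
      ⟨by rw [Category.assoc, hb, ha], by rw [← Category.assoc, ha', hb']⟩ (by simp)
  · exact (hu' Q'.carrier Q'.str π' hπ' hs').unique
      ⟨by rw [Category.assoc, ha, hb], by rw [← Category.assoc, hb', ha']⟩ (by simp)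

open Classical in
/-- The class `[X⁽²⁾]` of the symmetric square of `X`. The quotient `X⁽²⁾ = (X × X) / S₂` exists
as a variety whenever `X` is quasi-projective; it is unique up to isomorphism, so that the choice
is immaterial (see `symSquareCls_eq`). -/
def symSquareCls (X : Variety k) : K0 k :=
  if h : ∃ Q : Variety k, X.IsSymmetricSquare Q then h.choose.cls else 0

theorem cls_eq_of_iso {X Y : Variety k} (h : X.Iso Y) : X.cls = Y.cls :=
  Ideal.Quotient.eq.mpr (Ideal.subset_span (K0Rel.iso X Y h))

theorem symSquareCls_eq {X Q : Variety k} (h : X.IsSymmetricSquare Q) :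
    X.symSquareCls = Q.cls := by
  have h' : ∃ Q : Variety k, X.IsSymmetricSquare Q := ⟨Q, h⟩
  rw [symSquareCls, dif_pos h']
  exact cls_eq_of_iso (h'.choose_spec.iso h)

end Variety

section Projective

variable (k : Type u) [Field k] (σ : Type)

/-- The polynomial ring `k[x_i : i ∈ σ]`, graded by degree. -/
abbrev grading : ℕ → Submodule k (MvPolynomial σ k) := MvPolynomial.homogeneousSubmodule σ k

instance : GradedAlgebra (grading k σ) := MvPolynomial.gradedAlgebra

theorem algebraMap_grading_zero_surjective :
    Function.Surjective (algebraMap k (grading k σ 0)) := by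
  rintro ⟨p, hp⟩
  have hp' : p.IsHomogeneous 0 := hp
  refine ⟨p.coeff 0, Subtype.ext ?_⟩
  exact (MvPolynomial.totalDegree_eq_zero_iff_eq_C.mp
    (Nat.le_zero.mp hp'.totalDegree_le)).symm

instance : IsScalarTower k (grading k σ 0) (MvPolynomial σ k) :=
  ⟨fun c x p => smul_mul_assoc c (x : MvPolynomial σ k) p⟩

instance [Finite σ] : Algebra.FiniteType (grading k σ 0) (MvPolynomial σ k) :=
  Algebra.FiniteType.of_restrictScalars_finiteType k (grading k σ 0) (MvPolynomial σ k)

variable [Finite σ]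

/-- The projective space over `k` with homogeneous coordinates indexed by `σ`. -/
def projectiveSpace : Variety k where
  carrier := Proj (grading k σ)
  str := Proj.toSpecZero (grading k σ) ≫
    Spec.map (CommRingCat.ofHom (algebraMap k (grading k σ 0)))
  sep := inferInstance
  lft := by
    have : LocallyOfFiniteType
        (Spec.map (CommRingCat.ofHom (algebraMap k (grading k σ 0)))) := by
      rw [HasRingHomProperty.Spec_iff (P := @LocallyOfFiniteType)]
      exact RingHom.FiniteType.of_surjective _ (algebraMap_grading_zero_surjective k σ)
    infer_instance
  qc := inferInstance

/-- The zero locus in projective space of a set `E` of polynomials. -/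
def projectiveZeroLocus (E : Set (MvPolynomial σ k)) :
    TopologicalSpace.Closeds (projectiveSpace k σ).carrier :=
  ⟨ProjectiveSpectrum.zeroLocus (grading k σ) E,
    ProjectiveSpectrum.isClosed_zeroLocus (grading k σ) E⟩

/-- The zero locus of `E` as a projective variety, with the reduced structure. -/
def projectiveVariety (E : Set (MvPolynomial σ k)) : Variety k where
  carrier := (Scheme.IdealSheafData.vanishingIdeal (projectiveZeroLocus k σ E)).subscheme
  str := (Scheme.IdealSheafData.vanishingIdeal (projectiveZeroLocus k σ E)).subschemeι ≫
    (projectiveSpace k σ).str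
  sep := inferInstance
  lft := inferInstance
  qc := inferInstance

end Projective

section Cubic

variable {k : Type u} [Field k]

/-- `F` is a cubic form in four variables whose zero locus in `ℙ³` is smooth: the partial
derivatives of `F` do not vanish simultaneously at any point of it (`k` algebraically closed). -/
def IsSmoothCubicForm (F : MvPolynomial (Fin 4) k) : Prop :=
  F.IsHomogeneous 3 ∧ ∀ x : Fin 4 → k, x ≠ 0 → MvPolynomial.eval x F = 0 →
    ∃ i, MvPolynomial.eval x (MvPolynomial.pderiv i F) ≠ 0

/-- The surface `F = 0` in `ℙ³`. -/
def surface (F : MvPolynomial (Fin 4) k) : Variety k := projectiveVariety k (Fin 4) {F}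

/-- The index set of the Plücker coordinates `p_{ij}`, `i < j`, of lines in `ℙ³`. -/
abbrev PluckerIndex : Type := {p : Fin 4 × Fin 4 // p.1 < p.2}

/-- The Plücker coordinates `v_i w_j - v_j w_i` of the line through the points `v` and `w`. -/
def plucker (v w : Fin 4 → k) (p : PluckerIndex) : k :=
  v p.1.1 * w p.1.2 - v p.1.2 * w p.1.1

/-- `v` and `w` span a line in `ℙ³`, and this line is contained in the surface `F = 0`. -/
def IsLineIn (F : MvPolynomial (Fin 4) k) (v w : Fin 4 → k) : Prop :=
  LinearIndependent k ![v, w] ∧ ∀ a b : k, MvPolynomial.eval (a • v + b • w) F = 0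

/-- The Fano variety of lines `F(Y) ⊆ 𝔾(1, 3) ⊆ ℙ⁵` of the surface `Y : F = 0`: the reduced
closed subvariety of `ℙ⁵` that is cut out by all polynomials vanishing at the Plücker coordinates
of all lines contained in `Y`. Its closed points are the lines contained in `Y`, because these form
a closed subset of `ℙ⁵`. -/
def fanoOfLines (F : MvPolynomial (Fin 4) k) : Variety k :=
  projectiveVariety k PluckerIndex
    {G | ∀ v w, IsLineIn F v w → MvPolynomial.eval (plucker v w) G = 0}

end Cubic

section Relations

variable (Λ : Type v) [CommRing Λ] (k : Type u) [Field k]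

/-- The Grothendieck ring of varieties with coefficients in `Λ`. -/
def K0Coeff : Type (max v (u + 1)) := Λ ⊗[ℤ] K0 k

instance : CommRing (K0Coeff Λ k) := inferInstanceAs (CommRing (Λ ⊗[ℤ] K0 k))

instance : Algebra Λ (K0Coeff Λ k) := inferInstanceAs (Algebra Λ (Λ ⊗[ℤ] K0 k))

/-- The image of a class of the Grothendieck ring in the ring with coefficients in `Λ`. -/
def toCoeff : K0 k →+* K0Coeff Λ k :=
  (Algebra.TensorProduct.includeRight : K0 k →ₐ[ℤ] Λ ⊗[ℤ] K0 k).toRingHom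

/-- The class `𝕃 = [𝔸¹]`. -/
def lefschetz : K0Coeff Λ k := toCoeff Λ k (Variety.affineLine k).cls

/-- The subring `Λ[𝕃]` of the polynomials in `𝕃` with coefficients in `Λ`. -/
abbrev polyL : Subalgebra Λ (K0Coeff Λ k) := Algebra.adjoin Λ {lefschetz Λ k}

/-- `𝕃` as an element of `Λ[𝕃]`. -/
def lef : polyL Λ k := ⟨lefschetz Λ k, Algebra.subset_adjoin rfl⟩

/-- The polynomials in three variables `u₀, u₁, u₂`, with coefficients in `Λ[𝕃]`. -/
abbrev RelPoly : Type (max v (u + 1)) := MvPolynomial (Fin 3) (polyL Λ k)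

variable {k}

/-- The triple `([Y], [Y⁽²⁾], [F(Y)])` for the surface `Y : F = 0`. -/
def classes (F : MvPolynomial (Fin 4) k) : Fin 3 → K0Coeff Λ k :=
  ![toCoeff Λ k (surface F).cls, toCoeff Λ k (surface F).symSquareCls,
    toCoeff Λ k (fanoOfLines F).cls]

/-- `g` is a polynomial relation among `[Y]`, `[Y⁽²⁾]` and `[F(Y)]`. -/
def IsRelation (F : MvPolynomial (Fin 4) k) (g : RelPoly Λ k) : Prop :=
  MvPolynomial.aeval (classes Λ F) g = 0

variable (k)

/-- The polynomial `u₁ - (1 + 𝕃²) u₀ - 𝕃² u₂` of the `Y`–`F(Y)` relation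
`[Y⁽²⁾] - (1 + 𝕃²)[Y] - 𝕃²[F(Y)]`. -/
def yfPoly : RelPoly Λ k :=
  MvPolynomial.X 1 - MvPolynomial.C (1 + lef Λ k ^ 2) * MvPolynomial.X 0 -
    MvPolynomial.C (lef Λ k ^ 2) * MvPolynomial.X 2

end Relations

end CubicSurface

end

noncomputable section

namespace CubicSurface

/-! ### Embedding the base field into an ultraproduct of finite fields -/

section PseudofiniteField

/-! A smooth cubic surface contains only finitely many lines, so `F(Y)` is a finite set of
`k`-points and its class is a natural number `n`. Hence `g = u₂² - n u₂` is a relation with zero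
constant term; the value `n = 27` is never needed. The substitution `u₀ = 0`, `u₁ = 𝕃² t`, `u₂ = t`
kills `r`, so it sends the ideal of `r` to zero and every `A(r)` to a constant, whereas `g` goes to
`t² - n t`. The coefficient `1` of `t²` gives a contradiction as soon as `Λ[𝕃]` is not the zero
ring. Two substantial facts remain.

Nontriviality (`K0Coeff.nontrivial`). The field `k` embeds into an ultraproduct `K` of finite
fields, and the set `X(K)` is encoded by an ultraproduct of finite sets. The germ of their
cardinalities depends only on `X`, is additive on cuts and multiplicative on products, so it defines
a ring homomorphism `countHom` from `K0 k` to an ultrapower of `ℤ`. Thus `K0 k` has characteristic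
zero, and flatness of `Λ` over `ℤ` does the rest.

Finiteness of the lines (`IsSmoothCubicForm.finite_lines`). A first order deformation of a line in
`Y` is a linear syzygy between two binary quadratic forms, the restrictions of two partial
derivatives of `F`. Smoothness excludes common zeros, so the syzygy is trivial
(`linear_syzygy_eq_zero`). A finite type algebra without tangent vectors at its `k`-points has only
finitely many `k`-points (`finite_points_of_pointDerivation_eq_zero`). `finite_zeroLocus_of_finite`
and `Variety.exists_cls_eq_natCast` then turn finiteness into the value of the class. -/

theorem isJacobsonRing_int : IsJacobsonRing ℤ := by
  rw [isJacobsonRing_iff_prime_eq]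
  intro P hP
  by_cases h : P = ⊥
  · subst h
    refine le_antisymm (fun x hx => ?_) Ideal.le_jacobson
    rw [Ideal.mem_jacobson_bot] at hx
    have := Int.isUnit_iff.mp (hx x)
    have hx2 : x * x = 0 := by
      rcases this with h | h <;> nlinarith [mul_self_nonneg x]
    simpa using hx2
  · have := hP.isMaximal h
    exact Ideal.jacobson_eq_self_of_isMaximal

/-- A field which is finitely generated as a ring is finite. -/
theorem finite_of_finiteType_int (K : Type*) [Field K] (f : ℤ →+* K) (hf : f.FiniteType) :
    Finite K := by
  have := isJacobsonRing_int
  have hf' : (algebraMap ℤ K).FiniteType := by rwa [Subsingleton.elim (algebraMap ℤ K) f]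
  have : Algebra.FiniteType ℤ K := RingHom.finiteType_algebraMap.mp hf'
  -- Zariski's lemma over the Jacobson ring `ℤ`. Characteristic zero is then impossible, since `ℤ`
  -- would be a field, being a subring over which the field `K` is integral.
  have hfin : Module.Finite ℤ K := finite_of_finite_type_of_isJacobsonRing ℤ K
  obtain ⟨p, hp⟩ := CharP.exists K
  rcases CharP.char_is_prime_or_zero K p with h | h
  · have : Fact p.Prime := ⟨h⟩
    let _ : Algebra (ZMod p) K := ZMod.algebra K p
    have : Module.Finite (ZMod p) K := Module.Finite.of_restrictScalars_finite ℤ (ZMod p) K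
    exact Module.finite_of_finite (ZMod p)
  · subst h
    have : CharZero K := CharP.charP_to_charZero K
    exact absurd (isField_of_isIntegral_of_isField (R := ℤ) (S := K) Int.cast_injective
      (Field.toIsField K))
      Int.not_isField

/-- A field extension `K` of `k` which is presented as an ultraproduct of finite fields `A s`. -/
structure PseudofiniteExtension (k : Type u) [Field k] where
  /-- the index set -/
  I : Type u
  /-- the ultrafilter -/
  U : Ultrafilter I
  /-- the finite fields -/
  A : I → Type u
  [field : ∀ s, Field (A s)]
  [finite : ∀ s, Finite (A s)]
  /-- the ultraproduct -/
  K : Type u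
  [fieldK : Field K]
  [algebra : Algebra k K]
  /-- the class of a family -/
  π : (∀ s, A s) →+* K
  surj : Function.Surjective π
  eq_zero_iff : ∀ f, π f = 0 ↔ ∀ᶠ s in (U : Filter I), f s = 0

attribute [instance] PseudofiniteExtension.field PseudofiniteExtension.finite
  PseudofiniteExtension.fieldK PseudofiniteExtension.algebra

theorem PseudofiniteExtension.eq_iff {k : Type u} [Field k] (D : PseudofiniteExtension k)
    (f g : ∀ s, D.A s) : D.π f = D.π g ↔ ∀ᶠ s in (D.U : Filter D.I), f s = g s := by
  rw [← sub_eq_zero, ← map_sub, D.eq_zero_iff]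
  simp [sub_eq_zero]

/-- The families of elements that vanish almost everywhere. -/
def ultraIdeal {I : Type u} (U : Ultrafilter I) (A : I → Type v) [∀ s, Field (A s)] :
    Ideal (∀ s, A s) where
  carrier := {f | ∀ᶠ s in (U : Filter I), f s = 0}
  zero_mem' := by simp
  add_mem' := fun {f g} hf hg => by
    filter_upwards [hf, hg] with s h1 h2
    simp [h1, h2]
  smul_mem' := fun c f hf => by
    filter_upwards [hf] with s h
    simp [h]

instance ultraIdeal_isMaximal {I : Type u} (U : Ultrafilter I) (A : I → Type v)
    [∀ s, Field (A s)] : (ultraIdeal U A).IsMaximal := by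
  refine Ideal.isMaximal_iff.mpr ⟨fun h => ?_, fun J f hJ hf hfJ => ?_⟩
  · have h' : ∀ᶠ s in (U : Filter I), (1 : ∀ s, A s) s = 0 := h
    obtain ⟨s, hs⟩ := h'.exists
    exact one_ne_zero hs
  · have hf' : ∀ᶠ s in (U : Filter I), f s ≠ 0 := by
      rw [Ultrafilter.eventually_not]
      exact hf
    have h1 : (1 - f * fun s => (f s)⁻¹) ∈ ultraIdeal U A := by
      change ∀ᶠ s in (U : Filter I), _
      filter_upwards [hf'] with s hs
      simp [hs]
    have := J.add_mem (hJ h1) (J.mul_mem_right (fun s => (f s)⁻¹) hfJ)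
    simpa using this

/-- For each finite `s ⊆ k` the ring `ℤ[s]` has a finite residue field. Every element of `k` lies in
`ℤ[s]` for all large `s`, so reduction becomes a ring homomorphism in the limit along an ultrafilter
finer than `atTop`. -/
theorem exists_pseudofiniteExtension (k : Type u) [Field k] :
    Nonempty (PseudofiniteExtension k) := by
  classical
  have hm : ∀ s : Finset k, ∃ m : Ideal (Algebra.adjoin ℤ (s : Set k)), m.IsMaximal :=
    fun s => Ideal.exists_maximal _
  choose m hmax using hm
  let U : Ultrafilter (Finset k) := Ultrafilter.of Filter.atTop
  let A : Finset k → Type u := fun s => Algebra.adjoin ℤ (s : Set k) ⧸ m s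
  let _ : ∀ s, Field (A s) := fun s => Ideal.Quotient.field (m s)
  have hfin : ∀ s, Finite (A s) := fun s => by
    have : Algebra.FiniteType ℤ (Algebra.adjoin ℤ (s : Set k)) :=
      (Subalgebra.fg_iff_finiteType _).mp ⟨s, rfl⟩
    exact finite_of_finiteType_int (A s)
      ((Ideal.Quotient.mk (m s)).comp (algebraMap ℤ (Algebra.adjoin ℤ (s : Set k))))
      ((RingHom.FiniteType.of_surjective _ Ideal.Quotient.mk_surjective).comp
        (RingHom.finiteType_algebraMap.mpr this))
  let K := (∀ s, A s) ⧸ ultraIdeal U A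
  let _ : Field K := Ideal.Quotient.field _
  -- The value `0` outside `ℤ[s]` is junk, used only on a set of indices that the ultrafilter
  -- ignores.
  let red : k → ∀ s, A s := fun a s =>
    if h : a ∈ Algebra.adjoin ℤ (s : Set k) then Ideal.Quotient.mk (m s) ⟨a, h⟩ else 0
  have hU : (U : Filter (Finset k)) ≤ Filter.atTop := Ultrafilter.of_le _
  have hmem : ∀ a : k, ∀ᶠ s : Finset k in (U : Filter (Finset k)),
      a ∈ Algebra.adjoin ℤ (s : Set k) := by
    intro a
    refine hU ?_
    filter_upwards [Filter.eventually_ge_atTop {a}] with s hs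
    exact Algebra.subset_adjoin (hs (Finset.mem_singleton_self a))
  have key : ∀ f g : ∀ s, A s, (∀ᶠ s in (U : Filter (Finset k)), f s = g s) →
      (Ideal.Quotient.mk (ultraIdeal U A) f : K) = Ideal.Quotient.mk (ultraIdeal U A) g := by
    intro f g h
    refine Ideal.Quotient.eq.mpr ?_
    change ∀ᶠ s in (U : Filter (Finset k)), _
    filter_upwards [h] with s hs
    simp [hs]
  let κ : k →+* K :=
    { toFun := fun a => Ideal.Quotient.mk (ultraIdeal U A) (red a)
      map_one' := by
        rw [← map_one (Ideal.Quotient.mk (ultraIdeal U A))]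
        refine key _ _ ?_
        filter_upwards [hmem 1] with s hs
        simp only [red, dif_pos hs]
        exact map_one _
      map_zero' := by
        rw [← map_zero (Ideal.Quotient.mk (ultraIdeal U A))]
        refine key _ _ ?_
        filter_upwards [hmem 0] with s hs
        simp only [red, dif_pos hs]
        exact map_zero _
      map_add' := fun a b => by
        rw [← map_add]
        refine key _ _ ?_
        filter_upwards [hmem a, hmem b, hmem (a + b)] with s h1 h2 h3
        simp only [red, dif_pos h1, dif_pos h2, dif_pos h3, Pi.add_apply]
        exact map_add (Ideal.Quotient.mk (m s)) ⟨a, h1⟩ ⟨b, h2⟩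
      map_mul' := fun a b => by
        rw [← map_mul]
        refine key _ _ ?_
        filter_upwards [hmem a, hmem b, hmem (a * b)] with s h1 h2 h3
        simp only [red, dif_pos h1, dif_pos h2, dif_pos h3, Pi.mul_apply]
        exact map_mul (Ideal.Quotient.mk (m s)) ⟨a, h1⟩ ⟨b, h2⟩ }
  exact ⟨{ I := Finset k, U := U, A := A, K := K, algebra := κ.toAlgebra,
           π := Ideal.Quotient.mk _, surj := Ideal.Quotient.mk_surjective,
           eq_zero_iff := fun f => Ideal.Quotient.eq_zero_iff_mem }⟩

end PseudofiniteField

/-! ### Affine charts and points with values in the ultraproduct -/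

section Points

variable {k : Type u} [Field k]

/-- A morphism over `k` from the spectrum of a finitely generated `k`-algebra to `X`. -/
structure AffineChart (X : Variety k) where
  /-- the algebra -/
  R : Type u
  [commRing : CommRing R]
  [algebra : Algebra k R]
  [finiteType : Algebra.FiniteType k R]
  /-- the morphism -/
  ι : Spec (.of R) ⟶ X.carrier
  comm : ι ≫ X.str = Spec.map (CommRingCat.ofHom (algebraMap k R))

attribute [instance] AffineChart.commRing AffineChart.algebra AffineChart.finiteType

/-- The composition of a chart with a morphism of varieties. -/
def AffineChart.comp {X Y : Variety k} (c : AffineChart X) (f : X.carrier ⟶ Y.carrier)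
    (hf : f ≫ Y.str = X.str) : AffineChart Y where
  R := c.R
  ι := c.ι ≫ f
  comm := by rw [Category.assoc, hf, c.comm]

/-- The chart of `X` defined by a morphism from an affine scheme. -/
def AffineChart.ofIsAffine {X : Variety k} {W : Scheme.{u}} [IsAffine W] (f : W ⟶ X.carrier)
    [LocallyOfFiniteType f] : AffineChart X :=
  let φ : k →+* Γ(W, ⊤) := (Spec.preimage (W.isoSpec.inv ≫ f ≫ X.str)).hom
  have hφ : Spec.map (CommRingCat.ofHom φ) = W.isoSpec.inv ≫ f ≫ X.str :=
    Spec.map_preimage _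
  letI : Algebra k Γ(W, ⊤) := φ.toAlgebra
  { R := Γ(W, ⊤)
    finiteType := by
      have : LocallyOfFiniteType (Spec.map (CommRingCat.ofHom φ)) := by
        rw [hφ]
        infer_instance
      rw [HasRingHomProperty.Spec_iff (P := @LocallyOfFiniteType)] at this
      exact this
    ι := W.isoSpec.inv ≫ f
    comm := by
      rw [Category.assoc]
      exact hφ.symm }

theorem exists_finite_atlas (X : Variety k) :
    ∃ (J : Type u) (_ : Finite J) (c : J → AffineChart X),
      (∀ j, IsOpenImmersion (c j).ι) ∧ ∀ x : X.carrier, ∃ j, x ∈ Set.range (c j).ι := by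
  have : CompactSpace X.carrier := by
    have := X.qc
    exact (quasiCompact_iff_compactSpace (f := X.str)).mp this
  let 𝒰 := X.carrier.affineCover.finiteSubcover
  have haff : ∀ j, IsAffine (𝒰.X j) := fun j => inferInstance
  have hoi : ∀ j, IsOpenImmersion (𝒰.f j) := fun j => inferInstance
  refine ⟨𝒰.I₀, inferInstance, fun j => AffineChart.ofIsAffine (𝒰.f j), fun j => ?_, fun x => ?_⟩
  · change IsOpenImmersion ((𝒰.X j).isoSpec.inv ≫ 𝒰.f j)
    infer_instance
  · obtain ⟨j, y, hy⟩ := 𝒰.exists_eq x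
    refine ⟨j, (𝒰.X j).isoSpec.hom y, ?_⟩
    change ((𝒰.X j).isoSpec.inv ≫ 𝒰.f j) _ = x
    rw [← Scheme.Hom.comp_apply, Iso.hom_inv_id_assoc, hy]

variable (D : PseudofiniteExtension k)

/-- The points of `X` with coordinates in the ultraproduct. -/
def Point (X : Variety k) : Type u :=
  {x : Spec (.of D.K) ⟶ X.carrier //
    x ≫ X.str = Spec.map (CommRingCat.ofHom (algebraMap k D.K))}

variable {D} {X Y : Variety k}

/-- The image of a point. -/
def Point.map (x : Point D X) (f : X.carrier ⟶ Y.carrier) (hf : f ≫ Y.str = X.str) :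
    Point D Y :=
  ⟨x.1 ≫ f, by rw [Category.assoc, hf, x.2]⟩

/-- The point of `X` defined by a point of a chart. -/
def AffineChart.point (c : AffineChart X) (ψ : c.R →ₐ[k] D.K) : Point D X :=
  ⟨Spec.map (CommRingCat.ofHom ψ.toRingHom) ≫ c.ι, by
    rw [Category.assoc, c.comm, ← Spec.map_comp, ← CommRingCat.ofHom_comp]
    congr 2
    exact ψ.comp_algebraMap⟩

theorem AffineChart.exists_of_factors (c : AffineChart X) (x : Point D X)
    (l : Spec (.of D.K) ⟶ Spec (.of c.R)) (hl : l ≫ c.ι = x.1) :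
    ∃ ψ : c.R →ₐ[k] D.K, c.point ψ = x ∧ Spec.map (CommRingCat.ofHom ψ.toRingHom) = l := by
  have h1 : Spec.map (Spec.preimage l) = l := Spec.map_preimage l
  have h2 : (Spec.preimage l).hom.comp (algebraMap k c.R) = algebraMap k D.K := by
    have := x.2
    rw [← hl, Category.assoc, c.comm, ← h1, ← Spec.map_comp] at this
    exact congrArg CommRingCat.Hom.hom (Spec.map_injective this)
  refine ⟨{ (Spec.preimage l).hom with commutes' := fun a => congrArg (fun f => f a) h2 }, ?_, h1⟩
  refine Subtype.ext ?_
  change Spec.map (Spec.preimage l) ≫ c.ι = x.1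
  rw [h1, hl]

/-- The value at a `D.K`-point as a point of the underlying space. -/
def Point.pt (x : Point D X) : X.carrier := x.1 (IsLocalRing.closedPoint D.K)

theorem Point.range_eq (x : Point D X) : Set.range x.1 = {x.pt} := by
  ext y
  constructor
  · rintro ⟨p, rfl⟩
    rw [Subsingleton.elim p (IsLocalRing.closedPoint D.K)]
    rfl
  · rintro rfl
    exact ⟨_, rfl⟩

theorem AffineChart.exists_of_mem_range (c : AffineChart X) [IsOpenImmersion c.ι] (x : Point D X)
    (hx : x.pt ∈ Set.range c.ι) : ∃ ψ : c.R →ₐ[k] D.K, c.point ψ = x := by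
  obtain ⟨ψ, h, -⟩ := c.exists_of_factors x (IsOpenImmersion.lift c.ι x.1 (by
    rw [x.range_eq]; exact Set.singleton_subset_iff.mpr hx)) (IsOpenImmersion.lift_fac _ _ _)
  exact ⟨ψ, h⟩

theorem AffineChart.pt_point (c : AffineChart X) (ψ : c.R →ₐ[k] D.K) :
    ∃ p : Spec (.of c.R), (c.point ψ).pt = c.ι p ∧
      p.asIdeal = RingHom.ker ψ.toRingHom := by
  refine ⟨Spec.map (CommRingCat.ofHom ψ.toRingHom) (IsLocalRing.closedPoint D.K), ?_, ?_⟩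
  · exact Scheme.Hom.comp_apply _ _ _
  · change Ideal.comap ψ.toRingHom (IsLocalRing.maximalIdeal D.K) = _
    rw [IsLocalRing.maximalIdeal_eq_bot]
    rfl

theorem AffineChart.point_injective (c : AffineChart X) [Mono c.ι] :
    Function.Injective (c.point (D := D)) := by
  intro ψ ψ' h
  have h1 := congrArg Subtype.val h
  have h2 := Spec.map_injective ((cancel_mono c.ι).mp h1)
  have h3 : ψ.toRingHom = ψ'.toRingHom := congrArg CommRingCat.Hom.hom h2
  exact AlgHom.ext fun a => congrArg (fun f => f a) h3

end Points

/-! ### Tame functions and their images -/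

section Tame

variable {k : Type u} [Field k] {D : PseudofiniteExtension k} {X Y : Variety k}

/-- A function on the points of `X`, with values in families, which on each affine chart is given
almost everywhere by a family of functions of finitely many coordinates. -/
def Tame {E : D.I → Type u} (h : Point D X → ∀ s, E s) : Prop :=
  ∀ c : AffineChart X, ∃ (σ : Type u) (_ : Finite σ) (y : σ → c.R)
    (Φ : ∀ s, (σ → D.A s) → E s), ∀ (ψ : c.R →ₐ[k] D.K) (z : σ → ∀ s, D.A s),
      (∀ i, D.π (z i) = ψ (y i)) →
        ∀ᶠ s in (D.U : Filter D.I), h (c.point ψ) s = Φ s fun i => z i s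

/-- Tameness is tested on arbitrary morphisms from affine schemes, not only on open immersions, so a
chart of `X` composed with `f` is again a test object for `Y`. -/
theorem Tame.comp_map {E : D.I → Type u} {h : Point D Y → ∀ s, E s} (hh : Tame h)
    (f : X.carrier ⟶ Y.carrier) (hf : f ≫ Y.str = X.str) :
    Tame fun x : Point D X => h (x.map f hf) := by
  intro c
  obtain ⟨σ, hσ, y, Φ, H⟩ := hh (c.comp f hf)
  refine ⟨σ, hσ, y, Φ, fun ψ z hz => ?_⟩
  have : (c.point ψ).map f hf = (c.comp f hf).point ψ := Subtype.ext (Category.assoc _ _ _)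
  change ∀ᶠ s in (D.U : Filter D.I), h ((c.point ψ).map f hf) s = _
  rw [this]
  exact H ψ z hz

theorem Tame.prodMk {E E' : D.I → Type u} {h : Point D X → ∀ s, E s}
    {h' : Point D X → ∀ s, E' s} (hh : Tame h) (hh' : Tame h') :
    Tame (E := fun s => E s × E' s) fun x s => (h x s, h' x s) := by
  intro c
  obtain ⟨σ, hσ, y, Φ, H⟩ := hh c
  obtain ⟨σ', hσ', y', Φ', H'⟩ := hh' c
  refine ⟨σ ⊕ σ', inferInstance, Sum.elim y y',
    fun s z => (Φ s fun i => z (.inl i), Φ' s fun i => z (.inr i)), fun ψ z hz => ?_⟩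
  filter_upwards [H ψ (fun i => z (.inl i)) fun i => hz (.inl i),
    H' ψ (fun i => z (.inr i)) fun i => hz (.inr i)] with s h1 h2
  rw [h1, h2]

theorem Tame.pi {J : Type u} [Finite J] {E : J → D.I → Type u}
    {h : ∀ j, Point D X → ∀ s, E j s} (hh : ∀ j, Tame (h j)) :
    Tame (E := fun s => ∀ j, E j s) fun x s j => h j x s := by
  intro c
  choose σ hσ y Φ H using fun j => hh j c
  refine ⟨Σ j, σ j, inferInstance, fun i => y i.1 i.2,
    fun s z j => Φ j s fun i => z ⟨j, i⟩, fun ψ z hz => ?_⟩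
  filter_upwards [Filter.eventually_all.mpr fun j =>
    H j ψ (fun i => z ⟨j, i⟩) fun i => hz ⟨j, i⟩] with s h1
  exact funext h1

/-- A lift of the constants of `k` to families. -/
def liftConst (D : PseudofiniteExtension k) (a : k) : ∀ s, D.A s :=
  (D.surj (algebraMap k D.K a)).choose

theorem π_liftConst (a : k) : D.π (liftConst D a) = algebraMap k D.K a :=
  (D.surj (algebraMap k D.K a)).choose_spec

/-- The values of a polynomial over `k` on the finite fields. -/
def evalAt {n : ℕ} (p : MvPolynomial (Fin n) k) (s : D.I) (z : Fin n → D.A s) : D.A s :=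
  ∑ m ∈ p.support, liftConst D (p.coeff m) s * ∏ i, z i ^ m i

theorem π_evalAt {n : ℕ} (p : MvPolynomial (Fin n) k) (z : Fin n → ∀ s, D.A s) :
    D.π (fun s => evalAt p s fun i => z i s) = MvPolynomial.aeval (fun i => D.π (z i)) p := by
  have : (fun s => evalAt p s fun i => z i s) =
      ∑ m ∈ p.support, liftConst D (p.coeff m) * ∏ i, z i ^ m i := by
    funext s
    simp [evalAt, Finset.sum_apply, Finset.prod_apply]
  rw [this, MvPolynomial.aeval_def, MvPolynomial.eval₂_eq']
  simp [map_sum, map_mul, map_prod, π_liftConst]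

/-- The finite sets `T s` describe the image of `h`. -/
def HasImage {P : Type u} {E : D.I → Type u} (h : P → ∀ s, E s) (T : ∀ s, Set (E s)) : Prop :=
  (∀ s, (T s).Finite) ∧ (∀ x, ∀ᶠ s in (D.U : Filter D.I), h x s ∈ T s) ∧
    ∀ t : ∀ s, E s, (∀ᶠ s in (D.U : Filter D.I), t s ∈ T s) →
      ∃ x, ∀ᶠ s in (D.U : Filter D.I), h x s = t s

/-- A Łoś argument: a `K`-point of the chart is a solution of finitely many polynomial equations
(Hilbert's basis theorem), hence a family of solutions over almost all of the finite fields. -/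
theorem Tame.exists_hasImage_chart {E : D.I → Type u} {h : Point D X → ∀ s, E s} (hh : Tame h)
    (c : AffineChart X) :
    ∃ T : ∀ s, Set (E s), HasImage (D := D) (fun ψ : c.R →ₐ[k] D.K => h (c.point ψ)) T := by
  classical
  obtain ⟨σ, hσ, y, Φ, H⟩ := hh c
  obtain ⟨n, f, hf⟩ := Algebra.FiniteType.iff_quotient_mvPolynomial''.mp c.finiteType
  obtain ⟨G, hG⟩ := IsNoetherian.noetherian (RingHom.ker f.toRingHom)
  choose q hq using fun i => hf (y i)
  have hval : ∀ (ψ : c.R →ₐ[k] D.K) (z : Fin n → ∀ s, D.A s),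
      (∀ i, D.π (z i) = ψ (f (MvPolynomial.X i))) → ∀ p,
        D.π (fun s => evalAt p s fun i => z i s) = ψ (f p) := by
    intro ψ z hz p
    rw [π_evalAt]
    have : MvPolynomial.aeval (fun i => D.π (z i)) = ψ.comp f :=
      MvPolynomial.algHom_ext fun i => by simp [hz]
    rw [this]
    rfl
  refine ⟨fun s => {e | ∃ z : Fin n → D.A s, (∀ p ∈ G, evalAt p s z = 0) ∧
    Φ s (fun i => evalAt (q i) s z) = e}, fun s => ?_, fun ψ => ?_, fun t ht => ?_⟩
  · refine (Set.finite_range fun z : Fin n → D.A s => Φ s fun i => evalAt (q i) s z).subset ?_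
    rintro _ ⟨z, -, rfl⟩
    exact ⟨z, rfl⟩
  · choose z hz using fun i : Fin n => D.surj (ψ (f (MvPolynomial.X i)))
    have h1 : ∀ p ∈ G, ∀ᶠ s in (D.U : Filter D.I), evalAt p s (fun i => z i s) = 0 := by
      intro p hp
      have hp' : f p = 0 := by
        have : p ∈ RingHom.ker f.toRingHom := hG ▸ Submodule.subset_span hp
        exact this
      rw [← D.eq_zero_iff, hval ψ z hz, hp', map_zero]
    filter_upwards [(Filter.eventually_all_finset G).mpr h1,
      H ψ (fun j s => evalAt (q j) s fun i => z i s) fun j => by rw [hval ψ z hz, hq]] with s h2 h3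
    exact ⟨fun i => z i s, h2, h3.symm⟩
  · have h0 : ∀ s, ∃ z : Fin n → D.A s, t s ∈ {e | ∃ z : Fin n → D.A s,
        (∀ p ∈ G, evalAt p s z = 0) ∧ Φ s (fun i => evalAt (q i) s z) = e} →
        (∀ p ∈ G, evalAt p s z = 0) ∧ Φ s (fun i => evalAt (q i) s z) = t s := by
      intro s
      by_cases hs : t s ∈ {e | ∃ z : Fin n → D.A s,
        (∀ p ∈ G, evalAt p s z = 0) ∧ Φ s (fun i => evalAt (q i) s z) = e}
      · obtain ⟨z, hz⟩ := hs
        exact ⟨z, fun _ => hz⟩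
      · exact ⟨0, fun h => absurd h hs⟩
    choose w hw using h0
    let z : Fin n → ∀ s, D.A s := fun i s => w s i
    let φ : MvPolynomial (Fin n) k →ₐ[k] D.K := MvPolynomial.aeval fun i => D.π (z i)
    -- The chosen coordinates satisfy the generators of the kernel almost everywhere, so they define
    -- a point of the chart over the ultraproduct.
    have hker : RingHom.ker f.toRingHom ≤ RingHom.ker φ.toRingHom := by
      rw [← hG]
      refine Submodule.span_le.mpr fun p hp => ?_
      change φ p = 0
      rw [← π_evalAt, D.eq_zero_iff]
      filter_upwards [ht] with s hs
      exact (hw s hs).1 p hp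
    have hker' : ∀ a ∈ RingHom.ker f, φ a = 0 := fun a ha => hker ha
    let ψ : c.R →ₐ[k] D.K := (Ideal.Quotient.liftₐ (RingHom.ker f) φ hker').comp
      (Ideal.quotientKerAlgEquivOfSurjective hf).symm.toAlgHom
    have hψ : ∀ p, ψ (f p) = φ p := by
      intro p
      have : (Ideal.quotientKerAlgEquivOfSurjective hf).symm (f p) =
          Ideal.Quotient.mk (RingHom.ker f) p := by
        rw [AlgEquiv.symm_apply_eq]
        rfl
      change Ideal.Quotient.liftₐ (RingHom.ker f) φ hker'
        ((Ideal.quotientKerAlgEquivOfSurjective hf).symm (f p)) = _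
      rw [this]
      rfl
    refine ⟨ψ, ?_⟩
    filter_upwards [ht, H ψ (fun j s => evalAt (q j) s fun i => z i s) fun j => by
      rw [π_evalAt, ← hq, hψ]] with s h1 h2
    rw [h2]
    exact (hw s h1).2

theorem Tame.exists_hasImage {E : D.I → Type u} {h : Point D X → ∀ s, E s} (hh : Tame h) :
    ∃ T : ∀ s, Set (E s), HasImage (D := D) h T := by
  obtain ⟨J, hJ, c, hc, hcov⟩ := exists_finite_atlas X
  choose T hT using fun j => hh.exists_hasImage_chart (c j)
  refine ⟨fun s => ⋃ j, T j s, fun s => Set.finite_iUnion fun j => (hT j).1 s, fun x => ?_,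
    fun t ht => ?_⟩
  · obtain ⟨j, hj⟩ := hcov x.pt
    have := hc j
    obtain ⟨ψ, rfl⟩ := (c j).exists_of_mem_range x hj
    filter_upwards [(hT j).2.1 ψ] with s hs
    exact Set.mem_iUnion.mpr ⟨j, hs⟩
  · simp only [Set.mem_iUnion] at ht
    -- The atlas is finite, so the ultrafilter selects a single chart.
    obtain ⟨j, hj⟩ := Ultrafilter.eventually_exists_iff.mp ht
    obtain ⟨ψ, hψ⟩ := (hT j).2.2 t hj
    exact ⟨_, hψ⟩

end Tame

/-! ### Coordinates that separate points -/

section Coordinates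

variable {k : Type u} [Field k] {D : PseudofiniteExtension k} {X Y : Variety k}

/-- On a basic open set which is mapped into an open chart `c`, the coordinate functions of `c`
are fractions. -/
theorem AffineChart.exists_fractions (c c' : AffineChart X) [IsOpenImmersion c.ι] (g : c'.R)
    (hg : ∀ p : Spec (.of c'.R), g ∉ p.asIdeal → c'.ι p ∈ Set.range c.ι) :
    ∃ (a : c.R → c'.R) (N : c.R → ℕ), ∀ ψ : c'.R →ₐ[k] D.K, ψ g ≠ 0 →
      ∃ ψ' : c.R →ₐ[k] D.K, c.point ψ' = c'.point ψ ∧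
        ∀ b, ψ' b * ψ g ^ N b = ψ (a b) := by
  let S := Localization.Away g
  let r : Spec (.of S) ⟶ Spec (.of c'.R) :=
    Spec.map (CommRingCat.ofHom (algebraMap c'.R S))
  have hr : Set.range (r ≫ c'.ι) ⊆ Set.range c.ι := by
    rintro _ ⟨p, rfl⟩
    rw [Scheme.Hom.comp_apply]
    refine hg _ fun h => p.2.ne_top ?_
    have h' : algebraMap c'.R S g ∈ p.asIdeal := h
    exact Ideal.eq_top_of_isUnit_mem _ h' (IsLocalization.Away.algebraMap_isUnit g)
  let l := IsOpenImmersion.lift c.ι (r ≫ c'.ι) hr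
  have hl : l ≫ c.ι = r ≫ c'.ι := IsOpenImmersion.lift_fac _ _ _
  let θ : c.R →+* S := (Spec.preimage l).hom
  choose N a ha using fun b : c.R => IsLocalization.Away.surj g (θ b)
  refine ⟨a, N, fun ψ hψ => ?_⟩
  have hu : IsUnit (ψ.toRingHom g) := isUnit_iff_ne_zero.mpr hψ
  let e : S →+* D.K := IsLocalization.Away.lift g hu
  have he : e.comp (algebraMap c'.R S) = ψ.toRingHom := IsLocalization.Away.lift_comp g hu
  obtain ⟨ψ', h1, h2⟩ := c.exists_of_factors (c'.point ψ) (Spec.map (CommRingCat.ofHom e) ≫ l) (by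
    rw [Category.assoc, hl, ← Category.assoc, ← Spec.map_comp, ← CommRingCat.ofHom_comp, he]
    rfl)
  refine ⟨ψ', h1, fun b => ?_⟩
  have h3 : ψ'.toRingHom = e.comp θ := by
    have : Spec.map (CommRingCat.ofHom ψ'.toRingHom) =
        Spec.map (Spec.preimage l ≫ CommRingCat.ofHom e) := by
      rw [h2, Spec.map_comp, Spec.map_preimage]
    exact congrArg CommRingCat.Hom.hom (Spec.map_injective this)
  have h4 : ∀ x, e (algebraMap c'.R S x) = ψ x := fun x => congrArg (fun f => f x) he
  have h5 : ψ' b = e (θ b) := congrArg (fun f => f b) h3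
  have := congrArg e (ha b)
  rwa [map_mul, map_pow, h4, h4, ← h5] at this

theorem AffineChart.exists_basicOpen_cover (c c' : AffineChart X) [IsOpenImmersion c.ι] :
    ∃ (L : Type u) (_ : Finite L) (g : L → c'.R),
      ∀ p : Spec (.of c'.R), c'.ι p ∈ Set.range c.ι ↔ ∃ l, g l ∉ p.asIdeal := by
  have : IsNoetherianRing c'.R := Algebra.FiniteType.isNoetherianRing k c'.R
  let V : Set (PrimeSpectrum c'.R) := {p | c'.ι p ∈ Set.range c.ι}
  have hV : IsOpen V := (IsOpenImmersion.isOpen_range c.ι).preimage c'.ι.continuous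
  obtain ⟨s, hs⟩ := PrimeSpectrum.isOpen_iff V |>.mp hV
  obtain ⟨G, hG⟩ := IsNoetherian.noetherian (Ideal.span s)
  refine ⟨G, inferInstance, fun l => l.1, fun p => ?_⟩
  have h1 : p ∈ Vᶜ ↔ ∀ l ∈ G, l ∈ p.asIdeal := by
    rw [hs, ← PrimeSpectrum.zeroLocus_span, ← hG, ← Ideal.span, PrimeSpectrum.zeroLocus_span]
    rfl
  have h2 : c'.ι p ∈ Set.range c.ι ↔ ¬ p ∈ Vᶜ :=
    (@Set.notMem_compl_iff (PrimeSpectrum c'.R) V p).symm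
  rw [h2, h1]
  push Not
  exact ⟨fun ⟨l, h, h'⟩ => ⟨⟨l, h⟩, h'⟩, fun ⟨⟨l, h⟩, h'⟩ => ⟨l, h, h'⟩⟩

open Classical in
/-- The coordinates of a point with respect to a chart. -/
def AffineChart.coord (c : AffineChart X) {n : ℕ} (y : Fin n → c.R) (x : Point D X) (s : D.I) :
    Option (Fin n → D.A s) :=
  if h : ∃ ψ : c.R →ₐ[k] D.K, c.point ψ = x then
    some fun i => (D.surj (h.choose (y i))).choose s
  else none

theorem AffineChart.coord_point (c : AffineChart X) [IsOpenImmersion c.ι] {n : ℕ}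
    (y : Fin n → c.R) (ψ : c.R →ₐ[k] D.K) :
    ∃ w : Fin n → ∀ s, D.A s, (∀ i, D.π (w i) = ψ (y i)) ∧
      ∀ s, c.coord y (c.point ψ) s = some fun i => w i s := by
  have h : ∃ ψ' : c.R →ₐ[k] D.K, c.point ψ' = c.point ψ := ⟨ψ, rfl⟩
  have h' : h.choose = ψ := c.point_injective h.choose_spec
  refine ⟨fun i => (D.surj (h.choose (y i))).choose, fun i => ?_, fun s => dif_pos h⟩
  rw [(D.surj (h.choose (y i))).choose_spec, h']

theorem AffineChart.coord_of_not (c : AffineChart X) {n : ℕ} (y : Fin n → c.R) (x : Point D X)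
    (h : ¬ ∃ ψ : c.R →ₐ[k] D.K, c.point ψ = x) (s : D.I) : c.coord y x s = none :=
  dif_neg h

/-- The preimage of `c` in another chart is a finite union of basic open sets `g l ≠ 0`, on each of
which the coordinates are fractions with denominator a power of `g l`. Finitely many values
therefore determine both membership in `c` and the coordinates. -/
theorem AffineChart.tame_coord (c : AffineChart X) [IsOpenImmersion c.ι] {n : ℕ}
    (y : Fin n → c.R) : Tame (D := D) (c.coord y) := by
  classical
  intro c'
  obtain ⟨L, hL, g, hg⟩ := c.exists_basicOpen_cover c'
  choose a N H using fun l => c.exists_fractions (D := D) c' (g l) fun p hp => (hg p).mpr ⟨l, hp⟩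
  refine ⟨L ⊕ (L × ULift.{u} (Fin n)), inferInstance,
    Sum.elim g fun q => a q.1 (y q.2.down),
    fun s z => if h : ∃ l, z (.inl l) ≠ 0 then
      some fun i => z (.inr (h.choose, ⟨i⟩)) / z (.inl h.choose) ^ N h.choose (y i) else none,
    fun ψ z hz => ?_⟩
  have hz1 : ∀ l, D.π (z (.inl l)) = ψ (g l) := fun l => hz (.inl l)
  have hz2 : ∀ l i, D.π (z (.inr (l, ⟨i⟩))) = ψ (a l (y i)) := fun l i => hz (.inr (l, ⟨i⟩))
  obtain ⟨p, hp, hp'⟩ := c'.pt_point ψ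
  have hmem : ∀ b, b ∈ p.asIdeal ↔ ψ b = 0 := fun b => by rw [hp']; rfl
  have hiff : (c'.point ψ).pt ∈ Set.range c.ι ↔ ∃ l, ψ (g l) ≠ 0 := by
    rw [hp, hg p]
    simp only [hmem, ne_eq]
  by_cases hx : ∃ ψ' : c.R →ₐ[k] D.K, c.point ψ' = c'.point ψ
  · obtain ⟨ψ', hψ'⟩ := hx
    have hl0 : ∃ l, ψ (g l) ≠ 0 := by
      rw [← hiff, ← hψ']
      obtain ⟨q, hq, -⟩ := c.pt_point ψ'
      exact ⟨q, hq.symm⟩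
    obtain ⟨w, hw, hw'⟩ := c.coord_point y ψ'
    -- The formula must hold for every `l` at once, because the index picked by `choose` may vary
    -- with `s`.
    have h1 : ∀ l, ∀ᶠ s in (D.U : Filter D.I), z (.inl l) s ≠ 0 →
        ∀ i, w i s = z (.inr (l, ⟨i⟩)) s / z (.inl l) s ^ N l (y i) := by
      intro l
      by_cases hl : ψ (g l) = 0
      · have := (D.eq_zero_iff (z (.inl l))).mp ((hz1 l).trans hl)
        filter_upwards [this] with s hs h
        exact absurd hs h
      · obtain ⟨ψ'', h2, h3⟩ := H l ψ hl
        have h4 : ψ'' = ψ' := c.point_injective (h2.trans hψ'.symm)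
        subst h4
        have h5 : ∀ i, ∀ᶠ s in (D.U : Filter D.I),
            (w i * z (.inl l) ^ N l (y i)) s = z (.inr (l, ⟨i⟩)) s := by
          intro i
          rw [← D.eq_iff, map_mul, map_pow, hw, hz1, hz2, h3]
        filter_upwards [Filter.eventually_all.mpr h5] with s hs h i
        rw [eq_div_iff (pow_ne_zero _ h)]
        exact hs i
    obtain ⟨l0, hl0⟩ := hl0
    have h6 : ∀ᶠ s in (D.U : Filter D.I), z (.inl l0) s ≠ 0 := by
      rw [Ultrafilter.eventually_not, ← D.eq_zero_iff, hz1]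
      exact hl0
    filter_upwards [Filter.eventually_all.mpr h1, h6] with s h7 h8
    have h9 : ∃ l, z (.inl l) s ≠ 0 := ⟨l0, h8⟩
    rw [dif_pos h9, ← hψ', hw']
    exact congrArg some (funext fun i => h7 _ h9.choose_spec i)
  · have h0 : ∀ l, ψ (g l) = 0 := by
      intro l
      by_contra h
      exact hx (c.exists_of_mem_range _ (hiff.mpr ⟨l, h⟩))
    have h1 : ∀ l, ∀ᶠ s in (D.U : Filter D.I), z (.inl l) s = 0 := fun l =>
      (D.eq_zero_iff _).mp ((hz1 l).trans (h0 l))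
    filter_upwards [Filter.eventually_all.mpr h1] with s hs
    rw [c.coord_of_not y _ hx, dif_neg]
    rintro ⟨l, hl⟩
    exact hl (hs l)

/-- Different points have different images almost everywhere. -/
def Separating {P : Type u} {E : D.I → Type u} (h : P → ∀ s, E s) : Prop :=
  ∀ x x', (∀ᶠ s in (D.U : Filter D.I), h x s = h x' s) → x = x'

-- Coordinates in all charts of a finite atlas, with `none` outside a chart, distinguish any two
-- points.
variable (D X) in
theorem exists_tame_separating :
    ∃ (E : D.I → Type u) (_ : ∀ s, Nonempty (E s)) (h : Point D X → ∀ s, E s),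
      Tame h ∧ Separating h := by
  obtain ⟨J, hJ, c, hc, hcov⟩ := exists_finite_atlas X
  choose n f hf using fun j => Algebra.FiniteType.iff_quotient_mvPolynomial''.mp (c j).finiteType
  let y : ∀ j, Fin (n j) → (c j).R := fun j i => f j (MvPolynomial.X i)
  refine ⟨fun s => ∀ j, Option (Fin (n j) → D.A s), fun s => inferInstance,
    fun x s j => (c j).coord (y j) x s, Tame.pi fun j => (c j).tame_coord (y j),
    fun x x' hxx => ?_⟩
  obtain ⟨j, hj⟩ := hcov x.pt
  obtain ⟨ψ, rfl⟩ := (c j).exists_of_mem_range x hj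
  obtain ⟨w, hw, hw'⟩ := (c j).coord_point (y j) ψ
  have hxx' : ∀ᶠ s in (D.U : Filter D.I),
      (c j).coord (y j) ((c j).point ψ) s = (c j).coord (y j) x' s := by
    filter_upwards [hxx] with s hs
    exact congrFun hs j
  by_cases hx' : ∃ ψ' : (c j).R →ₐ[k] D.K, (c j).point ψ' = x'
  · obtain ⟨ψ', rfl⟩ := hx'
    obtain ⟨v, hv, hv'⟩ := (c j).coord_point (y j) ψ'
    have : ∀ i, ψ (y j i) = ψ' (y j i) := by
      intro i
      rw [← hw, ← hv, D.eq_iff]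
      filter_upwards [hxx'] with s hs
      rw [hw', hv'] at hs
      exact congrFun (Option.some_injective _ hs) i
    have h2 : ψ.comp (f j) = ψ'.comp (f j) := MvPolynomial.algHom_ext this
    have h3 : ψ = ψ' := AlgHom.ext fun a => by
      obtain ⟨q, rfl⟩ := hf j a
      exact congrArg (fun f => f q) h2
    rw [h3]
  · obtain ⟨s, hs⟩ := hxx'.exists
    rw [hw', (c j).coord_of_not (y j) _ hx'] at hs
    exact absurd hs (by simp)

end Coordinates

/-! ### Point counting as a motivic measure -/

section Counting

variable {k : Type u} [Field k] {D : PseudofiniteExtension k}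

/-- If the claim failed, a witness chosen at each bad index would assemble into a forbidden family.
This transfers statements about `K`-points to almost all of the finite sets. -/
theorem eventually_forall_not {E : D.I → Type u} [∀ s, Nonempty (E s)] {Q : ∀ s, E s → Prop}
    (h : ∀ t : ∀ s, E s, ¬ ∀ᶠ s in (D.U : Filter D.I), Q s (t s)) :
    ∀ᶠ s in (D.U : Filter D.I), ∀ e, ¬ Q s e := by
  by_contra hc
  have hex : ∀ s, ∃ t : E s, (∃ e, Q s e) → Q s t := by
    intro s
    by_cases hs : ∃ e, Q s e
    · exact ⟨hs.choose, fun _ => hs.choose_spec⟩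
    · exact ⟨Classical.arbitrary _, fun h => absurd h hs⟩
  choose t ht using hex
  refine h t ?_
  rw [← Ultrafilter.eventually_not] at hc
  filter_upwards [hc] with s hs
  push Not at hs
  exact ht s hs

/-- Each possible failure (leaving `T s`, a collision, a missed value), if it persisted, would be
realised by actual points of `P` and contradict `h = f ∘ h'` or the separation property of `h`. -/
theorem HasImage.eventually_bijOn {P : Type u} {E E' : D.I → Type u} [∀ s, Nonempty (E s)]
    [∀ s, Nonempty (E' s)] {h : P → ∀ s, E s} {h' : P → ∀ s, E' s} {T : ∀ s, Set (E s)}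
    {T' : ∀ s, Set (E' s)} (hT : HasImage (D := D) h T) (hT' : HasImage (D := D) h' T')
    (hs : Separating (D := D) h) (f : ∀ s, E' s → E s) (hf : ∀ x s, h x s = f s (h' x s)) :
    ∀ᶠ s in (D.U : Filter D.I), Set.BijOn (f s) (T' s) (T s) := by
  have h1 : ∀ᶠ s in (D.U : Filter D.I), ∀ e, ¬ (e ∈ T' s ∧ f s e ∉ T s) := by
    refine eventually_forall_not fun t ht => ?_
    obtain ⟨x, hx⟩ := hT'.2.2 t (ht.mono fun s h => h.1)
    obtain ⟨s, h1, h2, h3⟩ := (ht.and (hx.and (hT.2.1 x))).exists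
    rw [hf, h2] at h3
    exact h1.2 h3
  have h2 : ∀ᶠ s in (D.U : Filter D.I), ∀ e : E' s × E' s,
      ¬ (e.1 ∈ T' s ∧ e.2 ∈ T' s ∧ f s e.1 = f s e.2 ∧ e.1 ≠ e.2) := by
    refine eventually_forall_not fun t ht => ?_
    obtain ⟨x, hx⟩ := hT'.2.2 (fun s => (t s).1) (ht.mono fun s h => h.1)
    obtain ⟨y, hy⟩ := hT'.2.2 (fun s => (t s).2) (ht.mono fun s h => h.2.1)
    have hxy : x = y := hs x y (by
      filter_upwards [ht, hx, hy] with s h1 h2 h3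
      rw [hf, hf, h2, h3, h1.2.2.1])
    subst hxy
    obtain ⟨s, h1, h2, h3⟩ := (ht.and (hx.and hy)).exists
    exact h1.2.2.2 (h2.symm.trans h3)
  have h3 : ∀ᶠ s in (D.U : Filter D.I), ∀ e, ¬ (e ∈ T s ∧ e ∉ f s '' T' s) := by
    refine eventually_forall_not fun t ht => ?_
    obtain ⟨x, hx⟩ := hT.2.2 t (ht.mono fun s h => h.1)
    obtain ⟨s, h1, h2, h3⟩ := (ht.and (hx.and (hT'.2.1 x))).exists
    exact h1.2 ⟨_, h3, by rw [← hf, h2]⟩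
  filter_upwards [h1, h2, h3] with s h1 h2 h3
  refine ⟨fun e he => ?_, fun e he e' he' hee => ?_, fun e he => ?_⟩
  · by_contra h
    exact h1 e ⟨he, h⟩
  · by_contra h
    exact h2 (e, e') ⟨he, he', hee, h⟩
  · by_contra h
    exact h3 e ⟨he, h⟩

/-- The number of elements of a family of finite sets. -/
def germCard {E : D.I → Type u} (T : ∀ s, Set (E s)) : Filter.Germ (D.U : Filter D.I) ℤ :=
  ((fun s => ((T s).ncard : ℤ) : D.I → ℤ) : Filter.Germ (D.U : Filter D.I) ℤ)

/-- `c` is the number of points of `X` in the ultraproduct. -/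
def IsCount (X : Variety k) (c : Filter.Germ (D.U : Filter D.I) ℤ) : Prop :=
  ∃ (E : D.I → Type u) (_ : ∀ s, Nonempty (E s)) (h : Point D X → ∀ s, E s)
    (T : ∀ s, Set (E s)), Tame h ∧ Separating (D := D) h ∧ HasImage (D := D) h T ∧
      germCard T = c

variable {X Y Z : Variety k}

/-- Both encodings are compared with their product, whose image projects bijectively onto each of
the two images almost everywhere. -/
theorem IsCount.unique {c c' : Filter.Germ (D.U : Filter D.I) ℤ} (h : IsCount X c)
    (h' : IsCount X c') : c = c' := by
  obtain ⟨E, hE, h, T, ht, hs, hi, rfl⟩ := h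
  obtain ⟨E', hE', h', T', ht', hs', hi', rfl⟩ := h'
  obtain ⟨T2, hT2⟩ := (ht.prodMk ht').exists_hasImage
  have h1 := hi.eventually_bijOn hT2 hs (fun s e => e.1) fun x s => rfl
  have h2 := hi'.eventually_bijOn hT2 hs' (fun s e => e.2) fun x s => rfl
  refine Filter.Germ.coe_eq.mpr ?_
  filter_upwards [h1, h2] with s h1 h2
  rw [← h1.image_eq, ← h2.image_eq, h1.injOn.ncard_image, h2.injOn.ncard_image]

variable (D) in
theorem exists_isCount (X : Variety k) :
    ∃ c : Filter.Germ (D.U : Filter D.I) ℤ, IsCount X c := by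
  obtain ⟨E, hE, h, ht, hs⟩ := exists_tame_separating D X
  obtain ⟨T, hT⟩ := ht.exists_hasImage
  exact ⟨_, E, hE, h, T, ht, hs, hT, rfl⟩

variable (D) in
/-- The number of points of `X` in the ultraproduct. -/
def count (X : Variety k) : Filter.Germ (D.U : Filter D.I) ℤ := (exists_isCount D X).choose

theorem isCount_count (X : Variety k) : IsCount X (count D X) := (exists_isCount D X).choose_spec

theorem IsCount.count_eq {c : Filter.Germ (D.U : Filter D.I) ℤ} (h : IsCount X c) :
    count D X = c :=
  (isCount_count X).unique h

theorem Point.map_injective (f : X.carrier ⟶ Y.carrier) [Mono f] (hf : f ≫ Y.str = X.str) :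
    Function.Injective fun x : Point D X => x.map f hf := by
  intro x y hxy
  have := congrArg Subtype.val hxy
  exact Subtype.ext ((cancel_mono f).mp this)

theorem Separating.comp {P Q : Type u} {E : D.I → Type u} {h : P → ∀ s, E s}
    (hh : Separating (D := D) h) {φ : Q → P} (hφ : Function.Injective φ) :
    Separating (D := D) fun x => h (φ x) :=
  fun _ _ hxx => hφ (hh _ _ hxx)

theorem HasImage.comp {P Q : Type u} {E : D.I → Type u} {h : P → ∀ s, E s} {T : ∀ s, Set (E s)}
    (hh : HasImage (D := D) h T) {φ : Q → P} (hφ : Function.Surjective φ) :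
    HasImage (D := D) (fun x => h (φ x)) T := by
  refine ⟨hh.1, fun x => hh.2.1 _, fun t ht => ?_⟩
  obtain ⟨x, hx⟩ := hh.2.2 t ht
  obtain ⟨y, rfl⟩ := hφ x
  exact ⟨y, hx⟩

theorem count_eq_of_iso (h : X.Iso Y) : count D X = count D Y := by
  obtain ⟨e, he⟩ := h
  have he' : e.inv ≫ X.str = Y.str := by rw [← he, Iso.inv_hom_id_assoc]
  obtain ⟨E, hE, h, T, ht, hs, hi, hc⟩ := isCount_count (D := D) Y
  refine IsCount.count_eq ⟨E, hE, fun x => h (x.map e.hom he), T, ht.comp_map e.hom he,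
    hs.comp (Point.map_injective e.hom he), hi.comp fun y => ⟨y.map e.inv he', ?_⟩, hc⟩
  refine Subtype.ext ?_
  change (y.1 ≫ e.inv) ≫ e.hom = y.1
  simp

theorem exists_lift_of_closedImmersion (i : Z.carrier ⟶ X.carrier) [IsClosedImmersion i]
    (hi : i ≫ X.str = Z.str) (x : Point D X) (hx : x.pt ∈ Set.range i) :
    ∃ z : Point D Z, z.map i hi = x := by
  have hsurj : Surjective (pullback.snd i x.1) := by
    refine ⟨fun p => ?_⟩
    obtain ⟨z, hz⟩ := hx
    have hp : x.1 p = i z := by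
      rw [hz, Subsingleton.elim p (IsLocalRing.closedPoint D.K)]
      rfl
    obtain ⟨q, -, hq⟩ := Scheme.Pullback.exists_preimage_pullback z p hp.symm
    exact ⟨q, hq⟩
  -- A surjective closed immersion into the reduced scheme `Spec K` is an isomorphism.
  have : IsIso (pullback.snd i x.1) := isIso_of_isClosedImmersion_of_surjective _
  have h : (inv (pullback.snd i x.1) ≫ pullback.fst i x.1) ≫ i = x.1 := by
    rw [Category.assoc, pullback.condition, IsIso.inv_hom_id_assoc]
  exact ⟨⟨inv (pullback.snd i x.1) ≫ pullback.fst i x.1, by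
    rw [← hi, ← Category.assoc, h, x.2]⟩, Subtype.ext h⟩

theorem exists_lift_of_openImmersion (j : Z.carrier ⟶ X.carrier) [IsOpenImmersion j]
    (hj : j ≫ X.str = Z.str) (x : Point D X) (hx : x.pt ∈ Set.range j) :
    ∃ z : Point D Z, z.map j hj = x := by
  have hr : Set.range x.1 ⊆ Set.range j := by
    rw [x.range_eq]
    exact Set.singleton_subset_iff.mpr hx
  exact ⟨⟨IsOpenImmersion.lift j x.1 hr, by
    rw [← hj, ← Category.assoc, IsOpenImmersion.lift_fac, x.2]⟩,
    Subtype.ext (IsOpenImmersion.lift_fac _ _ _)⟩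

theorem Point.pt_map (x : Point D X) (f : X.carrier ⟶ Y.carrier) (hf : f ≫ Y.str = X.str) :
    (x.map f hf).pt = f x.pt :=
  Scheme.Hom.comp_apply _ _ _

theorem count_cut {W : Variety k} (h : X.IsCut Z W) : count D X = count D Z + count D W := by
  obtain ⟨i, j, hi, hj, hi', hj', hij⟩ := h
  obtain ⟨E, hE, h, ht, hs⟩ := exists_tame_separating D X
  have htZ := ht.comp_map i hi'
  have htW := ht.comp_map j hj'
  obtain ⟨TZ, hTZ⟩ := htZ.exists_hasImage
  obtain ⟨TW, hTW⟩ := htW.exists_hasImage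
  have hmem : ∀ z : Point D Z, ∀ w : Point D W, z.map i hi' ≠ w.map j hj' := by
    intro z w hzw
    have h1 : (z.map i hi').pt ∈ Set.range i := ⟨z.pt, (z.pt_map i hi').symm⟩
    have h2 : (w.map j hj').pt ∈ Set.range j := ⟨w.pt, (w.pt_map j hj').symm⟩
    rw [hij, ← hzw] at h2
    exact h2 h1
  have hX : HasImage (D := D) h fun s => TZ s ∪ TW s := by
    refine ⟨fun s => (hTZ.1 s).union (hTW.1 s), fun x => ?_, fun t ht => ?_⟩
    · by_cases hx : x.pt ∈ Set.range i
      · obtain ⟨z, rfl⟩ := exists_lift_of_closedImmersion i hi' x hx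
        exact (hTZ.2.1 z).mono fun s hs => Or.inl hs
      · have hx' : x.pt ∈ Set.range j := by
          rw [hij]
          exact hx
        obtain ⟨z, rfl⟩ := exists_lift_of_openImmersion j hj' x hx'
        exact (hTW.2.1 z).mono fun s hs => Or.inr hs
    · rcases Ultrafilter.eventually_or.mp ht with ht | ht
      · obtain ⟨z, hz⟩ := hTZ.2.2 t ht
        exact ⟨_, hz⟩
      · obtain ⟨w, hw⟩ := hTW.2.2 t ht
        exact ⟨_, hw⟩
  -- A persistent common value would come from a point of `Z` and a point of `W` with the same image
  -- in `X`.
  have hdis : ∀ᶠ s in (D.U : Filter D.I), ∀ e, ¬ (e ∈ TZ s ∧ e ∈ TW s) := by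
    refine eventually_forall_not fun t ht => ?_
    obtain ⟨z, hz⟩ := hTZ.2.2 t (ht.mono fun s h => h.1)
    obtain ⟨w, hw⟩ := hTW.2.2 t (ht.mono fun s h => h.2)
    refine hmem z w (hs _ _ ?_)
    filter_upwards [hz, hw] with s h1 h2
    exact h1.trans h2.symm
  have hcX : IsCount X (germCard (D := D) fun s => TZ s ∪ TW s) := ⟨E, hE, h, _, ht, hs, hX, rfl⟩
  have hcZ : IsCount Z (germCard (D := D) TZ) :=
    ⟨E, hE, _, _, htZ, hs.comp (Point.map_injective i hi'), hTZ, rfl⟩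
  have hcW : IsCount W (germCard (D := D) TW) :=
    ⟨E, hE, _, _, htW, hs.comp (Point.map_injective j hj'), hTW, rfl⟩
  rw [hcX.count_eq, hcZ.count_eq, hcW.count_eq]
  refine Filter.Germ.coe_eq.mpr ?_
  filter_upwards [hdis] with s hs'
  have hd : Disjoint (TZ s) (TW s) := Set.disjoint_left.mpr fun e h1 h2 => hs' e ⟨h1, h2⟩
  change (((TZ s ∪ TW s).ncard : ℕ) : ℤ) = ((TZ s).ncard : ℤ) + ((TW s).ncard : ℤ)
  rw [Set.ncard_union_eq hd (hTZ.1 s) (hTW.1 s), Nat.cast_add]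

theorem count_prod (X Y : Variety k) : count D (X.prod Y) = count D X * count D Y := by
  obtain ⟨E, hE, h, T, ht, hs, hi, hc⟩ := isCount_count (D := D) X
  obtain ⟨E', hE', h', T', ht', hs', hi', hc'⟩ := isCount_count (D := D) Y
  have h1 : (pullback.fst X.str Y.str : (X.prod Y).carrier ⟶ X.carrier) ≫ X.str =
      (X.prod Y).str := rfl
  have h2 : (pullback.snd X.str Y.str : (X.prod Y).carrier ⟶ Y.carrier) ≫ Y.str =
      (X.prod Y).str := pullback.condition.symm
  refine IsCount.count_eq ⟨fun s => E s × E' s, fun s => inferInstance,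
    fun x s => (h (x.map _ h1) s, h' (x.map _ h2) s), fun s => T s ×ˢ T' s,
    (ht.comp_map _ h1).prodMk (ht'.comp_map _ h2), fun x x' hxx => ?_,
    ⟨fun s => (hi.1 s).prod (hi'.1 s), fun x => ?_, fun t htt => ?_⟩, ?_⟩
  · have e1 := hs _ _ (hxx.mono fun s hs => congrArg Prod.fst hs)
    have e2 := hs' _ _ (hxx.mono fun s hs => congrArg Prod.snd hs)
    exact Subtype.ext (pullback.hom_ext (congrArg Subtype.val e1) (congrArg Subtype.val e2))
  · filter_upwards [hi.2.1 (x.map _ h1), hi'.2.1 (x.map _ h2)] with s a b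
    exact ⟨a, b⟩
  · obtain ⟨x, hx⟩ := hi.2.2 (fun s => (t s).1) (htt.mono fun s h => h.1)
    obtain ⟨y, hy⟩ := hi'.2.2 (fun s => (t s).2) (htt.mono fun s h => h.2)
    have hxy : x.1 ≫ X.str = y.1 ≫ Y.str := x.2.trans y.2.symm
    let z : Point D (X.prod Y) := ⟨pullback.lift x.1 y.1 hxy, by
      exact (pullback.lift_fst_assoc _ _ _ _).trans x.2⟩
    have z1 : z.map _ h1 = x := Subtype.ext (pullback.lift_fst _ _ _)
    have z2 : z.map _ h2 = y := Subtype.ext (pullback.lift_snd _ _ _)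
    refine ⟨z, ?_⟩
    filter_upwards [hx, hy] with s a b
    rw [z1, z2, a, b]
  · rw [← hc, ← hc']
    refine Filter.Germ.coe_eq.mpr (Filter.Eventually.of_forall fun s => ?_)
    change (((T s ×ˢ T' s).ncard : ℕ) : ℤ) = ((T s).ncard : ℤ) * ((T' s).ncard : ℤ)
    rw [Set.ncard_prod, Nat.cast_mul]

theorem count_point : count D (Variety.point k) = 1 := by
  let x0 : Point D (Variety.point k) :=
    ⟨Spec.map (CommRingCat.ofHom (algebraMap k D.K)), Category.comp_id _⟩
  have hx : ∀ x : Point D (Variety.point k), x = x0 := fun x =>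
    Subtype.ext ((Category.comp_id _).symm.trans x.2)
  refine IsCount.count_eq ⟨fun _ => PUnit, fun s => inferInstance, fun _ _ => PUnit.unit,
    fun s => Set.univ, fun c => ⟨PEmpty, inferInstance, PEmpty.elim, fun _ _ => PUnit.unit,
      fun _ _ _ => Filter.Eventually.of_forall fun s => rfl⟩,
    fun x x' _ => (hx x).trans (hx x').symm,
    ⟨fun s => Set.toFinite _, fun x => Filter.Eventually.of_forall fun s => Set.mem_univ _,
      fun t _ => ⟨x0, Filter.Eventually.of_forall fun s => rfl⟩⟩, ?_⟩
  refine Filter.Germ.coe_eq.mpr (Filter.Eventually.of_forall fun s => ?_)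
  change ((Set.univ : Set PUnit).ncard : ℤ) = 1
  simp

variable (D) in
/-- The motivic measure that counts points in the ultraproduct. -/
def countHom : K0 k →+* Filter.Germ (D.U : Filter D.I) ℤ :=
  Ideal.Quotient.lift _ (MvPolynomial.eval₂Hom (Int.castRingHom _) (count D)) (by
    suffices h : Ideal.span {p | K0Rel k p} ≤
        RingHom.ker (MvPolynomial.eval₂Hom (Int.castRingHom _) (count D)) from fun a ha => h ha
    refine Ideal.span_le.mpr fun p hp => ?_
    change MvPolynomial.eval₂Hom (Int.castRingHom _) (count D) p = 0
    cases hp with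
    | iso X Y h => simp [count_eq_of_iso h]
    | cut X Z U h => simp [count_cut h]
    | prod X Y => simp [count_prod]
    | point => simp [count_point])

instance K0.charZero (k : Type u) [Field k] : CharZero (K0 k) := by
  obtain ⟨D⟩ := exists_pseudofiniteExtension k
  refine charZero_of_inj_zero fun n hn => ?_
  have h := congrArg (countHom D) hn
  rw [map_natCast, map_zero] at h
  have h' : ∀ᶠ _ in (D.U : Filter D.I), (n : ℤ) = 0 := Filter.Germ.coe_eq.mp h
  obtain ⟨s, hs⟩ := h'.exists
  exact_mod_cast hs

/-- Since `Λ` is torsion-free, it is flat over `ℤ`, so the injection `ℤ → K0 k` stays injective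
after tensoring and embeds `Λ` into `K0Coeff Λ k`. -/
theorem K0Coeff.nontrivial (Λ : Type v) [CommRing Λ] [IsDomain Λ] [CharZero Λ]
    (k : Type u) [Field k] : Nontrivial (K0Coeff Λ k) := by
  have h : Function.Injective (Algebra.linearMap ℤ (K0 k)) :=
    (Int.castRingHom (K0 k)).injective_int
  have h' := Module.Flat.lTensor_preserves_injective_linearMap (M := Λ) _ h
  have : Nontrivial (Λ ⊗[ℤ] ℤ) := (TensorProduct.rid ℤ Λ).toEquiv.nontrivial
  exact h'.nontrivial

end Counting

/-! ### Finiteness from vanishing tangent spaces -/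

section Tangent

variable {k : Type u} [Field k]

/-- `d` is a derivation of `A` with values in `k` at the point `ρ`. -/
def IsPointDerivation {A : Type v} [CommRing A] [Algebra k A] (ρ : A →ₐ[k] k) (d : A →ₗ[k] k) :
    Prop :=
  ∀ a b, d (a * b) = ρ a * d b + ρ b * d a

theorem IsPointDerivation.map_algebraMap {A : Type v} [CommRing A] [Algebra k A] {ρ : A →ₐ[k] k}
    {d : A →ₗ[k] k} (h : IsPointDerivation ρ d) (c : k) : d (algebraMap k A c) = 0 := by
  have h1 : d 1 = 0 := by
    have := h 1 1
    simpa using this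
  rw [Algebra.algebraMap_eq_smul_one, map_smul, h1, smul_zero]

theorem IsPointDerivation.map_aeval {A : Type v} [CommRing A] [Algebra k A] {ρ : A →ₐ[k] k}
    {d : A →ₗ[k] k} (h : IsPointDerivation ρ d) {σ : Type*} [Fintype σ] (x : σ → A)
    (F : MvPolynomial σ k) :
    d (MvPolynomial.aeval x F) =
      ∑ i, MvPolynomial.eval (fun i => ρ (x i)) (MvPolynomial.pderiv i F) * d (x i) := by
  classical
  have hρ : ∀ p, ρ (MvPolynomial.aeval x p) = MvPolynomial.eval (fun i => ρ (x i)) p := by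
    intro p
    rw [← MvPolynomial.aeval_eq_eval]
    exact congrArg (fun f => f p) (MvPolynomial.comp_aeval x ρ)
  induction F using MvPolynomial.induction_on with
  | C c => simp [h.map_algebraMap]
  | add p q hp hq => simp [hp, hq, add_mul, Finset.sum_add_distrib]
  | mul_X p j hp =>
    rw [map_mul, h, hp, hρ, MvPolynomial.aeval_X, Finset.mul_sum]
    simp only [Derivation.leibniz, smul_eq_mul, map_add, map_mul, MvPolynomial.eval_X, add_mul,
      Finset.sum_add_distrib, MvPolynomial.pderiv_X]
    congr 1
    · rw [Finset.sum_eq_single j]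
      · simp
      · intro b _ hb
        simp [hb]
      · simp
    · exact Finset.sum_congr rfl fun i _ => by ring

/-- A nonzero finite module `Ω` has a simple quotient `A ⧸ m`, which is `k` by the Nullstellensatz;
composing with the universal derivation gives a nonzero point derivation. Hence `Ω = 0`, and an
unramified algebra of finite type over a field is finite. -/
theorem finite_points_of_pointDerivation_eq_zero [IsAlgClosed k] (A : Type u) [CommRing A]
    [Algebra k A] [Algebra.FiniteType k A]
    (H : ∀ (ρ : A →ₐ[k] k) (d : A →ₗ[k] k), IsPointDerivation ρ d → d = 0) :
    Finite (A →ₐ[k] k) := by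
  have hΩ : Subsingleton (Ω[A⁄k]) := by
    by_contra hns
    have : Nontrivial (Ω[A⁄k]) := not_subsingleton_iff_nontrivial.mp hns
    obtain ⟨N, hN, -⟩ := (eq_top_or_exists_le_coatom (⊥ : Submodule A (Ω[A⁄k]))).resolve_left
      bot_ne_top
    have hsimple : IsSimpleModule A (Ω[A⁄k] ⧸ N) := isSimpleModule_iff_isCoatom.mpr hN
    obtain ⟨m, hm, ⟨e⟩⟩ := isSimpleModule_iff_quot_maximal.mp hsimple
    let _ : Field (A ⧸ m) := Ideal.Quotient.field m
    have hft : Algebra.FiniteType k (A ⧸ m) :=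
      Algebra.FiniteType.of_surjective (Ideal.Quotient.mkₐ k m) Ideal.Quotient.mk_surjective
    have hfin : Module.Finite k (A ⧸ m) := finite_of_finite_type_of_isJacobsonRing k (A ⧸ m)
    have hbij : Function.Bijective (algebraMap k (A ⧸ m)) :=
      IsAlgClosed.algebraMap_bijective_of_isIntegral
    let ε : k ≃ₐ[k] A ⧸ m := AlgEquiv.ofBijective (Algebra.ofId k (A ⧸ m)) hbij
    let φ : Ω[A⁄k] →ₗ[A] A ⧸ m := e.toLinearMap ∘ₗ N.mkQ
    let ρ : A →ₐ[k] k := ε.symm.toAlgHom.comp (Ideal.Quotient.mkₐ k m)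
    let d : A →ₗ[k] k := ε.symm.toLinearMap ∘ₗ (φ.restrictScalars k) ∘ₗ
      (KaehlerDifferential.D k A).toLinearMap
    have hd : ∀ a, d a = ε.symm (φ (KaehlerDifferential.D k A a)) := fun a => rfl
    have hsm : ∀ (a : A) (x : A ⧸ m), a • x = Ideal.Quotient.mk m a * x := fun a x =>
      Algebra.smul_def a x
    have hder : IsPointDerivation ρ d := by
      intro a b
      rw [hd, hd, hd, Derivation.leibniz, map_add, map_smul, map_smul, hsm, hsm, map_add, map_mul,
        map_mul]
      rfl
    have h0 := H ρ d hder
    have hφ : ∀ a, φ (KaehlerDifferential.D k A a) = 0 := by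
      intro a
      have := hd a
      rw [h0, LinearMap.zero_apply] at this
      exact ε.symm.injective (this.symm.trans (map_zero _).symm)
    have hφ0 : φ = 0 := by
      refine LinearMap.ext_on (KaehlerDifferential.span_range_derivation k A) ?_
      rintro _ ⟨a, rfl⟩
      exact hφ a
    refine hN.1 (eq_top_iff.mpr fun x _ => ?_)
    have := congrArg (fun f => f x) hφ0
    have h1 : e (N.mkQ x) = 0 := this
    rw [e.map_eq_zero_iff] at h1
    exact (Submodule.Quotient.mk_eq_zero N).mp h1
  have : Algebra.FormallyUnramified k A := ⟨hΩ⟩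
  have : Module.Finite k A := Algebra.FormallyUnramified.finite_of_free k A
  exact Finite.algHom k A k

end Tangent

/-! ### Restricting forms to a line -/

section Lines

variable {k : Type u} [Field k]

/-- The restriction of a polynomial to the affine line `v + t w`. -/
def lineEval {σ : Type*} (v w : σ → k) (G : MvPolynomial σ k) : Polynomial k :=
  MvPolynomial.aeval (fun i => Polynomial.C (v i) + Polynomial.X * Polynomial.C (w i)) G

theorem eval_lineEval {σ : Type*} (v w : σ → k) (G : MvPolynomial σ k) (t : k) :
    (lineEval v w G).eval t = MvPolynomial.eval (v + t • w) G := by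
  rw [← Polynomial.coe_aeval_eq_eval, ← MvPolynomial.aeval_eq_eval]
  have := congrArg (fun f => f G) (MvPolynomial.comp_aeval
    (fun i => Polynomial.C (v i) + Polynomial.X * Polynomial.C (w i)) (Polynomial.aeval t))
  refine Eq.trans this ?_
  congr 2
  funext i
  simp only [map_add, map_mul, Polynomial.aeval_C, Polynomial.aeval_X, Algebra.algebraMap_self,
    RingHom.id_apply, Pi.add_apply, Pi.smul_apply, smul_eq_mul]

/-- The coefficient in degree `n` is the value at `w`, the point at infinity of the parametrised
line; it records a zero there. -/
theorem lineEval_degree {σ : Type*} [Fintype σ] (v w : σ → k) {G : MvPolynomial σ k} {n : ℕ}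
    (hG : G.IsHomogeneous n) :
    (lineEval v w G).natDegree ≤ n ∧ (lineEval v w G).coeff n = MvPolynomial.eval w G := by
  classical
  have hmon : ∀ (m : σ →₀ ℕ) (s : Finset σ),
      (∏ i ∈ s, (Polynomial.C (v i) + Polynomial.X * Polynomial.C (w i)) ^ m i).natDegree ≤
        ∑ i ∈ s, m i ∧
      (∏ i ∈ s, (Polynomial.C (v i) + Polynomial.X * Polynomial.C (w i)) ^ m i).coeff
        (∑ i ∈ s, m i) = ∏ i ∈ s, w i ^ m i := by
    intro m s
    have hlin : ∀ i, (Polynomial.C (v i) + Polynomial.X * Polynomial.C (w i)).natDegree ≤ 1 := by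
      intro i
      compute_degree
    have hpow : ∀ i, ((Polynomial.C (v i) + Polynomial.X * Polynomial.C (w i)) ^ m i).natDegree ≤
        m i := fun i => by simpa using Polynomial.natDegree_pow_le_of_le (m i) (hlin i)
    induction s using Finset.induction_on with
    | empty => simp
    | insert j s hj ih =>
      rw [Finset.prod_insert hj, Finset.sum_insert hj, Finset.prod_insert hj]
      refine ⟨Polynomial.natDegree_mul_le_of_le (hpow j) ih.1, ?_⟩
      rw [Polynomial.coeff_mul_add_eq_of_natDegree_le (hpow j) ih.1, ih.2]
      congr 1
      have := Polynomial.coeff_pow_of_natDegree_le (m := m j) (hlin j)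
      rw [mul_one] at this
      rw [this]
      simp
  have hsum : lineEval v w G = ∑ m ∈ G.support, Polynomial.C (G.coeff m) *
      ∏ i, (Polynomial.C (v i) + Polynomial.X * Polynomial.C (w i)) ^ m i := by
    rw [lineEval, MvPolynomial.aeval_def, MvPolynomial.eval₂_eq']
    rfl
  have hdeg : ∀ m ∈ G.support, ∑ i, m i = n := fun m hm => by
    have := hG (MvPolynomial.mem_support_iff.mp hm)
    rw [Finsupp.weight_apply, Finsupp.sum_fintype _ _ (by simp)] at this
    simpa using this
  rw [hsum]
  constructor
  · refine Polynomial.natDegree_sum_le_of_forall_le _ _ fun m hm => ?_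
    refine (Polynomial.natDegree_C_mul_le _ _).trans ?_
    rw [← hdeg m hm]
    exact (hmon m Finset.univ).1
  · rw [Polynomial.finsetSum_coeff, MvPolynomial.eval_eq']
    refine Finset.sum_congr rfl fun m hm => ?_
    rw [Polynomial.coeff_C_mul, ← hdeg m hm, (hmon m Finset.univ).2]

/-- If two quadrics on a line have no common zero, then a linear combination of them whose
coefficients are linear forms vanishes only if the coefficients do. -/
theorem linear_syzygy_eq_zero [IsAlgClosed k] {A B : Polynomial k} (hA : A.natDegree ≤ 2)
    (hB : B.natDegree ≤ 2) (h2 : A.coeff 2 ≠ 0 ∨ B.coeff 2 ≠ 0)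
    (hAB : ∀ t, ¬ (A.eval t = 0 ∧ B.eval t = 0)) {l m : Polynomial k} (hl : l.natDegree ≤ 1)
    (hm : m.natDegree ≤ 1) (h : l * A + m * B = 0) : l = 0 ∧ m = 0 := by
  wlog hA2 : A.coeff 2 ≠ 0 generalizing A B l m
  · have := this hB hA h2.symm (fun t ht => hAB t ht.symm) hm hl (by rw [add_comm, h])
      (h2.resolve_left hA2)
    exact this.symm
  have hcop : IsCoprime A B := by
    rw [Polynomial.isCoprime_iff_aeval_ne_zero_of_isAlgClosed k k]
    intro t
    have := hAB t
    rw [not_and_or] at this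
    simpa using this
  -- `A` divides `m * B` and is coprime to `B`. As `A` has degree two and `m` at most one, `m`
  -- vanishes.
  have hdvd : A ∣ m := by
    refine hcop.dvd_of_dvd_mul_right ?_
    exact ⟨-l, by linear_combination h⟩
  have hA' : 2 ≤ A.natDegree := Polynomial.le_natDegree_of_ne_zero hA2
  have hm0 : m = 0 := Polynomial.eq_zero_of_dvd_of_natDegree_lt hdvd (by omega)
  subst hm0
  have hA0 : A ≠ 0 := by
    rintro rfl
    simp at hA2
  refine ⟨?_, rfl⟩
  simpa [hA0] using h

end Lines

/-! ### Finiteness of the lines on a smooth cubic surface -/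

section LinesOnCubic

variable {k : Type u} [Field k]

theorem sum_pderiv_mul_eq_zero [Infinite k] {σ : Type*} [Fintype σ] {F : MvPolynomial σ k}
    {x v : σ → k} (h : ∀ r : k, MvPolynomial.eval (x + r • v) F = 0) :
    ∑ i, MvPolynomial.eval x (MvPolynomial.pderiv i F) * v i = 0 := by
  have h0 : lineEval x v F = 0 := Polynomial.funext fun r => by
    rw [eval_lineEval, h, Polynomial.eval_zero]
  let ρ : Polynomial k →ₐ[k] k := Polynomial.aeval 0
  let d : Polynomial k →ₗ[k] k := ρ.toLinearMap ∘ₗ Polynomial.derivative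
  have hd : IsPointDerivation ρ d := by
    intro a b
    simp only [d, ρ, LinearMap.comp_apply, Polynomial.derivative_mul, AlgHom.toLinearMap_apply,
      map_add, map_mul]
    ring
  have := hd.map_aeval (fun i => Polynomial.C (x i) + Polynomial.X * Polynomial.C (v i)) F
  change d (lineEval x v F) = _ at this
  rw [h0, map_zero] at this
  rw [this]
  refine Finset.sum_congr rfl fun i _ => ?_
  simp [d, ρ]

/-- The line in the standard chart of the Grassmannian with coordinates `p` passes through this
point on the plane `x₁ = 0`. -/
def chartFst (p : Fin 4 → k) : Fin 4 → k := ![1, 0, p 0, p 1]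

/-- The line in the standard chart of the Grassmannian with coordinates `p` passes through this
point on the plane `x₀ = 0`. -/
def chartSnd (p : Fin 4 → k) : Fin 4 → k := ![0, 1, p 2, p 3]

theorem smul_chartFst_add_ne_zero (p : Fin 4 → k) {a b : k} (h : a ≠ 0 ∨ b ≠ 0) :
    a • chartFst p + b • chartSnd p ≠ 0 := by
  intro h0
  have h1 := congrFun h0 0
  have h2 := congrFun h0 1
  simp [chartFst, chartSnd] at h1 h2
  rcases h with h | h
  · exact h h1
  · exact h h2

/-- The first order deformations of a line on a smooth cubic surface are trivial. -/
theorem IsSmoothCubicForm.deformation_eq_zero [IsAlgClosed k] {F : MvPolynomial (Fin 4) k}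
    (hF : IsSmoothCubicForm F) {p q : Fin 4 → k}
    (h0 : ∀ a b : k, MvPolynomial.eval (a • chartFst p + b • chartSnd p) F = 0)
    (h1 : ∀ t : k, MvPolynomial.eval (chartFst p + t • chartSnd p) (MvPolynomial.pderiv 2 F) *
        (q 0 + t * q 2) +
      MvPolynomial.eval (chartFst p + t • chartSnd p) (MvPolynomial.pderiv 3 F) *
        (q 1 + t * q 3) = 0) : q = 0 := by
  have hinf : Infinite k := IsAlgClosed.instInfinite
  -- The gradient of `F` along the line annihilates both spanning vectors. If its last two entries
  -- vanish, the shape `(1, 0, *, *)`, `(0, 1, *, *)` makes the first two vanish too, against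
  -- smoothness.
  have hne : ∀ a b : k, a ≠ 0 ∨ b ≠ 0 →
      ¬ (MvPolynomial.eval (a • chartFst p + b • chartSnd p) (MvPolynomial.pderiv 2 F) = 0 ∧
        MvPolynomial.eval (a • chartFst p + b • chartSnd p) (MvPolynomial.pderiv 3 F) = 0) := by
    rintro a b hab ⟨e2, e3⟩
    have d1 := sum_pderiv_mul_eq_zero (F := F) (x := a • chartFst p + b • chartSnd p)
      (v := chartFst p) fun r => by
        rw [show a • chartFst p + b • chartSnd p + r • chartFst p =
          (a + r) • chartFst p + b • chartSnd p by module]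
        exact h0 _ _
    have d2 := sum_pderiv_mul_eq_zero (F := F) (x := a • chartFst p + b • chartSnd p)
      (v := chartSnd p) fun r => by
        rw [show a • chartFst p + b • chartSnd p + r • chartSnd p =
          a • chartFst p + (b + r) • chartSnd p by module]
        exact h0 _ _
    rw [Fin.sum_univ_four, e2, e3] at d1 d2
    have e0 : MvPolynomial.eval (a • chartFst p + b • chartSnd p)
        (MvPolynomial.pderiv 0 F) = 0 := by
      simpa [chartFst] using d1
    have e1 : MvPolynomial.eval (a • chartFst p + b • chartSnd p)
        (MvPolynomial.pderiv 1 F) = 0 := by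
      simpa [chartSnd] using d2
    obtain ⟨i, hi⟩ := hF.2 _ (smul_chartFst_add_ne_zero p hab) (h0 a b)
    fin_cases i
    · exact hi e0
    · exact hi e1
    · exact hi e2
    · exact hi e3
  have hdeg : ∀ i, (MvPolynomial.pderiv i F).IsHomogeneous 2 := fun i => hF.1.pderiv
  have hA := lineEval_degree (chartFst p) (chartSnd p) (hdeg 2)
  have hB := lineEval_degree (chartFst p) (chartSnd p) (hdeg 3)
  -- Absence of a common zero at infinity says that one of the two quadratic polynomials has degree
  -- exactly two.
  have hw := hne 0 1 (Or.inr one_ne_zero)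
  rw [zero_smul, zero_add, one_smul, ← hA.2, ← hB.2, not_and_or] at hw
  have key := linear_syzygy_eq_zero hA.1 hB.1 hw (fun t => by
      have := hne 1 t (Or.inl one_ne_zero)
      rwa [one_smul, ← eval_lineEval, ← eval_lineEval] at this)
    (l := Polynomial.C (q 0) + Polynomial.X * Polynomial.C (q 2))
    (m := Polynomial.C (q 1) + Polynomial.X * Polynomial.C (q 3))
    (by compute_degree) (by compute_degree) (Polynomial.funext fun t => by
      have := h1 t
      simp only [Polynomial.eval_add, Polynomial.eval_mul, Polynomial.eval_C, Polynomial.eval_X,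
        eval_lineEval, Polynomial.eval_zero]
      linear_combination this)
  have c0 := congrArg (fun f => Polynomial.coeff f 0) key.1
  have c1 := congrArg (fun f => Polynomial.coeff f 1) key.1
  have c2 := congrArg (fun f => Polynomial.coeff f 0) key.2
  have c3 := congrArg (fun f => Polynomial.coeff f 1) key.2
  simp [Polynomial.coeff_C] at c0 c1 c2 c3
  funext i
  fin_cases i
  · exact c0
  · exact c2
  · exact c1
  · exact c3

/-- The finitely many lines on a smooth cubic surface in the standard chart of the
Grassmannian. -/
theorem IsSmoothCubicForm.finite_lines_chart [IsAlgClosed k] {F : MvPolynomial (Fin 4) k}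
    (hF : IsSmoothCubicForm F) :
    {p : Fin 4 → k | ∀ a b : k,
      MvPolynomial.eval (a • chartFst p + b • chartSnd p) F = 0}.Finite := by
  let R := MvPolynomial (Fin 4) k
  let V : Fin 4 → R := ![1, 0, MvPolynomial.X 0, MvPolynomial.X 1]
  let W : Fin 4 → R := ![0, 1, MvPolynomial.X 2, MvPolynomial.X 3]
  let x : k → k → Fin 4 → R := fun a b i => a • V i + b • W i
  let G : k → k → R := fun a b => MvPolynomial.aeval (x a b) F
  -- `R ⧸ J` is the coordinate ring of the scheme of lines in this chart, and its point derivations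
  -- are the first order deformations of a line.
  let J : Ideal R := Ideal.span {g | ∃ a b, G a b = g}
  have hx : ∀ (ρ : R →ₐ[k] k) (a b : k), (fun i => ρ (x a b i)) =
      a • chartFst (fun i => ρ (MvPolynomial.X i)) +
        b • chartSnd (fun i => ρ (MvPolynomial.X i)) := by
    intro ρ a b
    funext i
    fin_cases i <;> simp [x, V, W, chartFst, chartSnd]
  have hG : ∀ (ρ : R →ₐ[k] k) (a b : k), ρ (G a b) = MvPolynomial.eval
      (a • chartFst (fun i => ρ (MvPolynomial.X i)) +
        b • chartSnd (fun i => ρ (MvPolynomial.X i))) F := by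
    intro ρ a b
    rw [← hx, ← MvPolynomial.aeval_eq_eval]
    exact congrArg (fun f => f F) (MvPolynomial.comp_aeval (x a b) ρ)
  have hGJ : ∀ a b, Ideal.Quotient.mk J (G a b) = 0 := fun a b =>
    Ideal.Quotient.eq_zero_iff_mem.mpr (Ideal.subset_span ⟨a, b, rfl⟩)
  have hfin : Finite ((R ⧸ J) →ₐ[k] k) := by
    refine finite_points_of_pointDerivation_eq_zero _ fun ρ d hd => ?_
    let mk : R →ₐ[k] R ⧸ J := Ideal.Quotient.mkₐ k J
    let ρ' : R →ₐ[k] k := ρ.comp mk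
    let d' : R →ₗ[k] k := d ∘ₗ mk.toLinearMap
    have hd' : IsPointDerivation ρ' d' := fun a b => by
      change d (mk (a * b)) = ρ (mk a) * d (mk b) + ρ (mk b) * d (mk a)
      rw [map_mul, hd]
    have hd1 : d' 1 = 0 := by
      have := hd'.map_algebraMap 1
      rwa [map_one] at this
    have hq : (fun i => d' (MvPolynomial.X i)) = 0 := by
      refine hF.deformation_eq_zero (p := fun i => ρ' (MvPolynomial.X i)) (fun a b => ?_)
        fun t => ?_
      · rw [← hG]
        change ρ (mk (G a b)) = 0
        rw [show mk (G a b) = 0 from hGJ a b, map_zero]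
      · have h1 := hd'.map_aeval (x 1 t) F
        have h2 : d' (MvPolynomial.aeval (x 1 t) F) = 0 := by
          change d (mk (G 1 t)) = 0
          rw [show mk (G 1 t) = 0 from hGJ 1 t, map_zero]
        rw [h2, hx, one_smul, Fin.sum_univ_four] at h1
        rw [h1]
        simp [x, V, W, hd1]
    refine LinearMap.ext fun a => ?_
    obtain ⟨b, rfl⟩ := Ideal.Quotient.mk_surjective a
    have h1 := hd'.map_aeval MvPolynomial.X b
    rw [MvPolynomial.aeval_X_left_apply] at h1
    have h2 : d' b = 0 := by
      rw [h1]
      exact Finset.sum_eq_zero fun i _ => by rw [show d' (MvPolynomial.X i) = 0 from congrFun hq i,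
        mul_zero]
    exact h2
  refine (Set.finite_range fun (ρ : (R ⧸ J) →ₐ[k] k) (i : Fin 4) =>
    ρ (Ideal.Quotient.mk J (MvPolynomial.X i))).subset fun p hp => ?_
  have hker : ∀ a ∈ J, MvPolynomial.aeval p a = (0 : k) := by
    suffices h : J ≤ RingHom.ker (MvPolynomial.aeval p : R →ₐ[k] k) from fun a ha => h ha
    refine Ideal.span_le.mpr ?_
    rintro _ ⟨a, b, rfl⟩
    change (MvPolynomial.aeval p : R →ₐ[k] k) (G a b) = 0
    rw [hG]
    have hX : (fun i => (MvPolynomial.aeval p : R →ₐ[k] k) (MvPolynomial.X i)) = p :=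
      funext fun i => MvPolynomial.aeval_X p i
    rw [hX]
    exact hp a b
  refine ⟨Ideal.Quotient.liftₐ J (MvPolynomial.aeval p) hker, ?_⟩
  funext i
  exact MvPolynomial.aeval_X p i

theorem IsSmoothCubicForm.rename_equiv {F : MvPolynomial (Fin 4) k} (hF : IsSmoothCubicForm F)
    (τ : Equiv.Perm (Fin 4)) : IsSmoothCubicForm (MvPolynomial.rename τ F) := by
  refine ⟨hF.1.rename_isHomogeneous, fun x hx h => ?_⟩
  rw [MvPolynomial.eval_rename] at h
  have hx' : x ∘ τ ≠ 0 := fun h0 => hx (funext fun j => by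
    have := congrFun h0 (τ.symm j)
    simpa using this)
  obtain ⟨i, hi⟩ := hF.2 (x ∘ τ) hx' h
  refine ⟨τ i, ?_⟩
  rwa [MvPolynomial.pderiv_rename τ.injective, MvPolynomial.eval_rename]

theorem plucker_smul_combination (v w : Fin 4 → k) (a b c d : k) :
    plucker (a • v + b • w) (c • v + d • w) = (a * d - b * c) • plucker v w := by
  funext p
  simp only [plucker, Pi.add_apply, Pi.smul_apply, smul_eq_mul]
  ring

theorem exists_plucker_ne_zero {v w : Fin 4 → k} (h : LinearIndependent k ![v, w]) :
    ∃ p, plucker v w p ≠ 0 := by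
  by_contra! h0
  have h1 : ∀ i j, v i * w j = v j * w i := by
    intro i j
    rcases lt_trichotomy i j with hij | rfl | hij
    · exact sub_eq_zero.mp (h0 ⟨(i, j), hij⟩)
    · rfl
    · exact (sub_eq_zero.mp (h0 ⟨(j, i), hij⟩)).symm
  rw [LinearIndependent.pair_iff] at h
  have hv : ∀ i, v i = 0 := by
    intro i
    -- All minors vanish, so `w i • v - v i • w = 0` for every `i`, and independence forces `v i =
    -- 0`.
    have := h (w i) (-v i) (by
      funext j
      simp only [Pi.add_apply, Pi.smul_apply, smul_eq_mul, Pi.zero_apply]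
      linear_combination -(h1 i j))
    exact neg_eq_zero.mp this.2
  have := h 1 0 (by
    funext j
    simp [hv])
  exact one_ne_zero this.1

theorem exists_perm_zero_one : ∀ i j : Fin 4, i < j →
    ∃ σ : Equiv.Perm (Fin 4), σ 0 = i ∧ σ 1 = j := by
  decide

/-- Up to scalar factors, the lines on a smooth cubic surface have finitely many Plücker
coordinates. -/
theorem IsSmoothCubicForm.finite_lines [IsAlgClosed k] {F : MvPolynomial (Fin 4) k}
    (hF : IsSmoothCubicForm F) :
    ∃ P : Set (PluckerIndex → k), P.Finite ∧ (∀ p ∈ P, p ≠ 0) ∧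
      ∀ v w, IsLineIn F v w → ∃ p ∈ P, ∃ c : k, plucker v w = c • p := by
  let Φ : Equiv.Perm (Fin 4) → (Fin 4 → k) → PluckerIndex → k := fun σ p =>
    plucker (chartFst p ∘ σ.symm) (chartSnd p ∘ σ.symm)
  let Z : Equiv.Perm (Fin 4) → Set (Fin 4 → k) := fun σ => {p | ∀ a b : k,
    MvPolynomial.eval (a • chartFst p + b • chartSnd p) (MvPolynomial.rename σ.symm F) = 0}
  refine ⟨⋃ σ ∈ {σ : Equiv.Perm (Fin 4) | σ 0 < σ 1}, Φ σ '' Z σ, ?_, ?_, ?_⟩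
  · exact (Set.toFinite _).biUnion fun σ _ =>
      ((hF.rename_equiv σ.symm).finite_lines_chart).image _
  · intro p hp h0
    simp only [Set.mem_iUnion] at hp
    obtain ⟨σ, hσ, q, -, rfl⟩ := hp
    have := congrFun h0 ⟨(σ 0, σ 1), hσ⟩
    simp [Φ, plucker, chartFst, chartSnd] at this
  · rintro v w ⟨hvw, hF0⟩
    obtain ⟨⟨⟨i, j⟩, hij⟩, hp⟩ := exists_plucker_ne_zero hvw
    obtain ⟨σ, rfl, rfl⟩ := exists_perm_zero_one i j hij
    set δ := plucker v w ⟨(σ 0, σ 1), hij⟩ with hδ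
    have hδ' : δ = v (σ 0) * w (σ 1) - v (σ 1) * w (σ 0) := rfl
    -- The matrix with rows `v`, `w` is multiplied by the inverse of its minor in columns `σ 0`, `σ
    -- 1`, which moves the line into the standard chart.
    let v' : Fin 4 → k := (w (σ 1) / δ) • v + (-v (σ 1) / δ) • w
    let w' : Fin 4 → k := (-w (σ 0) / δ) • v + (v (σ 0) / δ) • w
    let p : Fin 4 → k := ![v' (σ 2), v' (σ 3), w' (σ 2), w' (σ 3)]
    have hv : chartFst p = v' ∘ σ := by
      funext l
      fin_cases l
      · simp only [chartFst, v', Function.comp_apply, Pi.add_apply, Pi.smul_apply, smul_eq_mul]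
        change (1 : k) = w (σ 1) / δ * v (σ 0) + -v (σ 1) / δ * w (σ 0)
        field_simp
        rw [hδ']
        ring
      · simp only [chartFst, v', Function.comp_apply, Pi.add_apply, Pi.smul_apply, smul_eq_mul]
        change (0 : k) = w (σ 1) / δ * v (σ 1) + -v (σ 1) / δ * w (σ 1)
        ring
      · rfl
      · rfl
    have hw : chartSnd p = w' ∘ σ := by
      funext l
      fin_cases l
      · simp only [chartSnd, w', Function.comp_apply, Pi.add_apply, Pi.smul_apply, smul_eq_mul]
        change (0 : k) = -w (σ 0) / δ * v (σ 0) + v (σ 0) / δ * w (σ 0)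
        ring
      · simp only [chartSnd, w', Function.comp_apply, Pi.add_apply, Pi.smul_apply, smul_eq_mul]
        change (1 : k) = -w (σ 0) / δ * v (σ 1) + v (σ 0) / δ * w (σ 1)
        field_simp
        rw [hδ']
        ring
      · rfl
      · rfl
    have hcomp : ∀ u : Fin 4 → k, (u ∘ σ) ∘ σ.symm = u := fun u => by
      funext l
      simp
    refine ⟨Φ σ p, Set.mem_biUnion (x := σ) hij ⟨p, fun a b => ?_, rfl⟩, δ, ?_⟩
    · rw [MvPolynomial.eval_rename]
      have : (a • chartFst p + b • chartSnd p) ∘ σ.symm = a • v' + b • w' := by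
        rw [hv, hw]
        change a • ((v' ∘ σ) ∘ σ.symm) + b • ((w' ∘ σ) ∘ σ.symm) = _
        rw [hcomp, hcomp]
      rw [this, show a • v' + b • w' = (a * (w (σ 1) / δ) + b * (-w (σ 0) / δ)) • v +
        (a * (-v (σ 1) / δ) + b * (v (σ 0) / δ)) • w by simp only [v', w']; module]
      exact hF0 _ _
    · simp only [Φ]
      rw [hv, hw, hcomp, hcomp]
      simp only [v', w']
      rw [plucker_smul_combination, smul_smul]
      have : δ * (w (σ 1) / δ * (v (σ 0) / δ) - -v (σ 1) / δ * (-w (σ 0) / δ)) = 1 := by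
        field_simp
        rw [hδ']
        ring
      rw [this, one_smul]

end LinesOnCubic

/-! ### Classes of finite varieties -/

section FiniteVarieties

variable {k : Type u} [Field k]

theorem Variety.cls_eq_add {X Z U : Variety k} (h : X.IsCut Z U) : X.cls = Z.cls + U.cls := by
  have h1 : Ideal.Quotient.mk (Ideal.span {p | K0Rel k p})
      (MvPolynomial.X X - MvPolynomial.X Z - MvPolynomial.X U) = 0 :=
    Ideal.Quotient.eq_zero_iff_mem.mpr (Ideal.subset_span (K0Rel.cut X Z U h))
  rw [map_sub, map_sub, sub_sub, sub_eq_zero] at h1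
  exact h1

theorem Variety.cls_point : (Variety.point k).cls = 1 := by
  have h1 : Ideal.Quotient.mk (Ideal.span {p | K0Rel k p})
      (MvPolynomial.X (Variety.point k) - 1) = 0 :=
    Ideal.Quotient.eq_zero_iff_mem.mpr (Ideal.subset_span K0Rel.point)
  rw [map_sub, sub_eq_zero] at h1
  exact h1

/-- The empty variety is cut into two copies of itself, so its class equals its double. -/
theorem Variety.cls_of_isEmpty (X : Variety k) [IsEmpty X.carrier] : X.cls = 0 := by
  have h : X.IsCut X X := ⟨𝟙 _, 𝟙 _, inferInstance, inferInstance, Category.id_comp _,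
    Category.id_comp _, Set.ext fun x => isEmptyElim x⟩
  simpa using X.cls_eq_add h

/-- The class of a variety with finitely many points is the number of its points. -/
theorem Variety.exists_cls_eq_natCast [IsAlgClosed k] :
    ∀ (n : ℕ) (X : Variety k) [Finite X.carrier], Nat.card X.carrier = n → X.cls = n := by
  intro n
  induction n with
  | zero =>
    intro X _ hX
    have : IsEmpty X.carrier := Finite.card_eq_zero_iff.mp hX
    rw [X.cls_of_isEmpty, Nat.cast_zero]
  | succ n ih =>
    intro X _ hX
    have hne : Nonempty X.carrier := Finite.card_pos_iff.mp (by omega)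
    have : CompactSpace X.carrier := Finite.compactSpace
    obtain ⟨x, -, hx⟩ := IsClosed.exists_closed_singleton (isClosed_univ (X := X.carrier))
      Set.univ_nonempty
    -- Over an algebraically closed field a closed point is rational; removing it leaves a variety
    -- with one point fewer.
    let i : Spec (.of k) ⟶ X.carrier := pointOfClosedPoint X.str x hx
    have hi : i ≫ X.str = 𝟙 _ := pointOfClosedPoint_comp X.str x hx
    have hi' : IsClosedImmersion i := isClosedImmersion_of_comp_eq_id _ _ hi
    have hr : Set.range i = {x} := by
      ext y
      constructor
      · rintro ⟨p, rfl⟩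
        exact pointOfClosedPoint_apply X.str x hx p
      · intro hy
        rw [Set.mem_singleton_iff.mp hy]
        exact ⟨IsLocalRing.closedPoint k, pointOfClosedPoint_apply X.str x hx _⟩
    let O : X.carrier.Opens := ⟨{x}ᶜ, hx.isOpen_compl⟩
    have hfin : Finite (O : Scheme) := inferInstanceAs (Finite ({x}ᶜ : Set X.carrier))
    have hqc : CompactSpace (O : Scheme) := Finite.compactSpace
    let U : Variety k :=
      { carrier := O
        str := O.ι ≫ X.str
        sep := inferInstance
        lft := inferInstance
        qc := (quasiCompact_iff_compactSpace (f := O.ι ≫ X.str)).mpr hqc }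
    have hcut : X.IsCut (Variety.point k) U :=
      ⟨i, O.ι, hi', inferInstance, hi, rfl, O.range_ι.trans (congrArg compl hr.symm)⟩
    have hcard : Nat.card U.carrier = n := by
      have h1 : Nat.card ({x}ᶜ : Set X.carrier) = n := by
        rw [Nat.card_coe_set_eq, Set.ncard_compl, Set.ncard_singleton, hX]
        rfl
      exact h1
    have : Finite U.carrier := hfin
    rw [X.cls_eq_add hcut, Variety.cls_point, ih U hcard]
    push_cast
    ring

end FiniteVarieties

/-! ### Finite subsets of projective space -/

section ProjectivePoints

variable {k : Type u} [Field k] {σ : Type} [Finite σ]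

/-- The ideal of the line through `p`. -/
def pointIdeal (p : σ → k) : Ideal (MvPolynomial σ k) :=
  ⨅ c : k, RingHom.ker (MvPolynomial.eval (c • p))

omit [Finite σ] in
theorem mem_pointIdeal {p : σ → k} {f : MvPolynomial σ k} :
    f ∈ pointIdeal p ↔ ∀ c : k, MvPolynomial.eval (c • p) f = 0 := by
  simp [pointIdeal, RingHom.mem_ker]

theorem eval_smul_of_isHomogeneous {f : MvPolynomial σ k} {n : ℕ} (hf : f.IsHomogeneous n)
    (c : k) (p : σ → k) : MvPolynomial.eval (c • p) f = c ^ n * MvPolynomial.eval p f := by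
  have := Fintype.ofFinite σ
  rw [MvPolynomial.eval_eq', MvPolynomial.eval_eq', Finset.mul_sum]
  refine Finset.sum_congr rfl fun m hm => ?_
  have hdeg := hf (MvPolynomial.mem_support_iff.mp hm)
  rw [Finsupp.weight_apply, Finsupp.sum_fintype _ _ (by simp)] at hdeg
  have hdeg' : ∑ i, m i = n := by simpa using hdeg
  simp only [Pi.smul_apply, smul_eq_mul, mul_pow, Finset.prod_mul_distrib,
    Finset.prod_pow_eq_pow_sum, hdeg']
  ring

/-- A point of projective space whose ideal contains the ideal of the `k`-point `p` is equal
to `p`. -/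
theorem mem_iff_of_pointIdeal_le {p : σ → k} (hp : p ≠ 0) (x : ProjectiveSpectrum (grading k σ))
    (hx : pointIdeal p ≤ x.asHomogeneousIdeal.toIdeal) {f : MvPolynomial σ k} {n : ℕ}
    (hf : f.IsHomogeneous n) :
    f ∈ x.asHomogeneousIdeal.toIdeal ↔ MvPolynomial.eval p f = 0 := by
  constructor
  · intro hfx
    by_contra h0
    obtain ⟨j, hj⟩ := Function.ne_iff.mp hp
    have hprime := x.isPrime
    -- This form vanishes on the line through `p`. With `f` in the prime it forces `X j`, and then
    -- every variable, into the prime, which would contain the irrelevant ideal.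
    have h1 : MvPolynomial.C (MvPolynomial.eval p f) * MvPolynomial.X j ^ n -
        MvPolynomial.C (p j ^ n) * f ∈ pointIdeal p := by
      rw [mem_pointIdeal]
      intro c
      simp [eval_smul_of_isHomogeneous hf]
      ring
    have h2 : MvPolynomial.C (MvPolynomial.eval p f) * MvPolynomial.X j ^ n ∈
        x.asHomogeneousIdeal.toIdeal := by
      have := Ideal.add_mem _ (hx h1) (Ideal.mul_mem_left _ (MvPolynomial.C (p j ^ n)) hfx)
      simpa using this
    have hunit : ∀ {c : k} {q : MvPolynomial σ k}, c ≠ 0 →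
        MvPolynomial.C c * q ∈ x.asHomogeneousIdeal.toIdeal →
          q ∈ x.asHomogeneousIdeal.toIdeal := by
      intro c q hc hq
      have := Ideal.mul_mem_left _ (MvPolynomial.C c⁻¹) hq
      rwa [← mul_assoc, ← map_mul, inv_mul_cancel₀ hc, map_one, one_mul] at this
    have h3 : MvPolynomial.X j ∈ x.asHomogeneousIdeal.toIdeal :=
      hprime.mem_of_pow_mem _ (hunit h0 h2)
    have h4 : ∀ i, MvPolynomial.X i ∈ x.asHomogeneousIdeal.toIdeal := by
      intro i
      have h5 : MvPolynomial.C (p j) * MvPolynomial.X i -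
          MvPolynomial.C (p i) * MvPolynomial.X j ∈ pointIdeal p := by
        rw [mem_pointIdeal]
        intro c
        simp
        ring
      refine hunit hj ?_
      have := Ideal.add_mem _ (hx h5) (Ideal.mul_mem_left _ (MvPolynomial.C (p i)) h3)
      simpa using this
    refine x.not_irrelevant_le ?_
    change (HomogeneousIdeal.irrelevant (grading k σ)).toIdeal ≤ x.asHomogeneousIdeal.toIdeal
    rw [HomogeneousIdeal.irrelevant_eq_span]
    refine Ideal.span_le.mpr fun q hq => ?_
    simp only [Set.mem_iUnion] at hq
    obtain ⟨d, hd, hq⟩ := hq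
    have hq' : q.IsHomogeneous d := hq
    have h6 : Ideal.span (MvPolynomial.X '' (Set.univ : Set σ)) ≤
        x.asHomogeneousIdeal.toIdeal := by
      refine Ideal.span_le.mpr ?_
      rintro _ ⟨i, -, rfl⟩
      exact h4 i
    refine h6 (MvPolynomial.mem_ideal_span_X_image.mpr fun m hm => ?_)
    by_contra! hm0
    have hm' : m = 0 := Finsupp.ext fun i => hm0 i (Set.mem_univ i)
    have := hq' (MvPolynomial.mem_support_iff.mp hm)
    rw [hm', map_zero] at this
    exact hd.ne this
  · intro h0
    refine hx (mem_pointIdeal.mpr fun c => ?_)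
    rw [eval_smul_of_isHomogeneous hf, h0, mul_zero]

theorem eq_of_pointIdeal_le {p : σ → k} (hp : p ≠ 0) {x y : ProjectiveSpectrum (grading k σ)}
    (hx : pointIdeal p ≤ x.asHomogeneousIdeal.toIdeal)
    (hy : pointIdeal p ≤ y.asHomogeneousIdeal.toIdeal) : x = y := by
  refine ProjectiveSpectrum.ext (HomogeneousIdeal.ext' fun n f hf => ?_)
  exact (mem_iff_of_pointIdeal_le hp x hx hf).trans (mem_iff_of_pointIdeal_le hp y hy hf).symm

/-- A prime containing a finite intersection of ideals contains one of them, and at most one point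
of `Proj` lies over each `pointIdeal p`. Non-closed points are thereby excluded as well. -/
theorem finite_zeroLocus_of_finite {P : Set (σ → k)} (hP : P.Finite) (hP0 : ∀ p ∈ P, p ≠ 0)
    {E : Set (MvPolynomial σ k)} (hE : ∀ f, (∀ p ∈ P, f ∈ pointIdeal p) → f ∈ E) :
    (ProjectiveSpectrum.zeroLocus (grading k σ) E).Finite := by
  classical
  have hex : ∀ x ∈ ProjectiveSpectrum.zeroLocus (grading k σ) E,
      ∃ p ∈ P, pointIdeal p ≤ x.asHomogeneousIdeal.toIdeal := by
    intro x hx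
    have hprime := x.isPrime
    have h1 : hP.toFinset.inf pointIdeal ≤ x.asHomogeneousIdeal.toIdeal := by
      intro f hf
      refine hx (hE f fun p hp => ?_)
      exact (Finset.inf_le (f := pointIdeal) (hP.mem_toFinset.mpr hp) :
        hP.toFinset.inf pointIdeal ≤ pointIdeal p) hf
    obtain ⟨p, hp, h⟩ := (Ideal.IsPrime.inf_le' hprime).mp h1
    exact ⟨p, hP.mem_toFinset.mp hp, h⟩
  choose! φ hφ hφ' using hex
  exact Set.Finite.of_injOn (f := φ) (t := P) (fun x hx => hφ x hx)
    (fun x hx y hy hxy => eq_of_pointIdeal_le (hP0 _ (hφ x hx)) (hφ' x hx) (hxy ▸ hφ' y hy)) hP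

end ProjectivePoints

/-! ### The extra relation -/

section MainResult

variable {k : Type u} [Field k] [IsAlgClosed k]

theorem IsSmoothCubicForm.exists_cls_fanoOfLines {F : MvPolynomial (Fin 4) k}
    (hF : IsSmoothCubicForm F) : ∃ n : ℕ, (fanoOfLines F).cls = n := by
  obtain ⟨P, hP, hP0, hlines⟩ := hF.finite_lines
  have hfin : ((projectiveZeroLocus k PluckerIndex {G | ∀ v w, IsLineIn F v w →
      MvPolynomial.eval (plucker v w) G = 0} : TopologicalSpace.Closeds _) :
      Set (projectiveSpace k PluckerIndex).carrier).Finite := by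
    refine finite_zeroLocus_of_finite hP hP0 fun f hf v w hvw => ?_
    obtain ⟨p, hp, c, hc⟩ := hlines v w hvw
    rw [hc]
    exact mem_pointIdeal.mp (hf p hp) c
  have : Finite (fanoOfLines F).carrier := by
    let 𝓘 := Scheme.IdealSheafData.vanishingIdeal (projectiveZeroLocus k PluckerIndex
      {G | ∀ v w, IsLineIn F v w → MvPolynomial.eval (plucker v w) G = 0})
    have hinj : Function.Injective 𝓘.subschemeι := 𝓘.subschemeι.isClosedEmbedding.injective
    refine Set.finite_univ_iff.mp
      (Set.Finite.of_injOn (f := 𝓘.subschemeι) (fun x _ => ?_) hinj.injOn hfin)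
    have h1 : 𝓘.subschemeι x ∈ Set.range 𝓘.subschemeι := ⟨x, rfl⟩
    rw [𝓘.range_subschemeι, Scheme.IdealSheafData.coe_support_vanishingIdeal] at h1
    exact h1
  exact ⟨_, Variety.exists_cls_eq_natCast _ _ rfl⟩

-- The simpler relation `u₂ - n` may have a nonzero constant term; multiplying it by `u₂` removes
-- that term.
omit [IsAlgClosed k] in
theorem isRelation_fano (Λ : Type v) [CommRing Λ] {F : MvPolynomial (Fin 4) k} {n : ℕ}
    (h : (fanoOfLines F).cls = n) :
    IsRelation Λ F (MvPolynomial.X 2 ^ 2 - (n : RelPoly Λ k) * MvPolynomial.X 2) := by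
  have h2 : classes Λ F 2 = n := by
    change toCoeff Λ k (fanoOfLines F).cls = n
    rw [h, map_natCast]
  unfold IsRelation
  rw [map_sub, map_mul, map_pow, map_natCast, MvPolynomial.aeval_X, h2]
  ring

variable (k) in
/-- The substitution `u₀ = 0`, `u₁ = 𝕃² t`, `u₂ = t`, for which the `Y`–`F(Y)` relation
vanishes. -/
def fanoSubst (Λ : Type v) [CommRing Λ] :
    RelPoly Λ k →ₐ[polyL Λ k] Polynomial (polyL Λ k) :=
  MvPolynomial.aeval ![0, Polynomial.C (lef Λ k ^ 2) * Polynomial.X, Polynomial.X]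

omit [IsAlgClosed k] in
theorem fanoSubst_yfPoly (Λ : Type v) [CommRing Λ] : fanoSubst k Λ (yfPoly Λ k) = 0 := by
  simp [fanoSubst, yfPoly]

omit [IsAlgClosed k] in
theorem coeff_fanoSubst (Λ : Type v) [CommRing Λ] (n : ℕ) :
    (fanoSubst k Λ (MvPolynomial.X 2 ^ 2 - (n : RelPoly Λ k) * MvPolynomial.X 2)).coeff 2 = 1 := by
  rw [map_sub, map_mul, map_pow, map_natCast]
  simp [fanoSubst]

end MainResult

end CubicSurface

end

theorem mainTheorem10 {k : Type u} [Field k] [IsAlgClosed k] [CharZero k]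
    (Λ : Type v) [CommRing Λ] [IsDomain Λ] [CharZero Λ]
    (F : MvPolynomial (Fin 4) k) (hF : CubicSurface.IsSmoothCubicForm F) :
    ∃ g : CubicSurface.RelPoly Λ k,
      MvPolynomial.constantCoeff g = 0 ∧
      CubicSurface.IsRelation Λ F g ∧
      g ∉ Ideal.span {CubicSurface.yfPoly Λ k} ∧
      ∀ A : Polynomial (CubicSurface.polyL Λ k),
        g ≠ Polynomial.aeval (CubicSurface.yfPoly Λ k) A := by
  obtain ⟨n, hn⟩ := hF.exists_cls_fanoOfLines
  have := CubicSurface.K0Coeff.nontrivial Λ k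
  have hc := CubicSurface.coeff_fanoSubst (k := k) Λ n
  refine ⟨_, ?_, CubicSurface.isRelation_fano Λ hn, fun hg => ?_, fun A hA => ?_⟩
  · simp
  · obtain ⟨q, hq⟩ := Ideal.mem_span_singleton.mp hg
    rw [hq, map_mul, CubicSurface.fanoSubst_yfPoly, zero_mul, Polynomial.coeff_zero] at hc
    exact zero_ne_one hc
  -- After the substitution `A(r)` becomes the constant `A(0)`, which has no term in degree two.
  · rw [hA, ← Polynomial.aeval_algHom_apply, CubicSurface.fanoSubst_yfPoly,
      ← Polynomial.coeff_zero_eq_aeval_zero', Polynomial.algebraMap_eq,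
      Polynomial.coeff_C_of_ne_zero two_ne_zero] at hc
    exact zero_ne_one hc
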